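/- Let $(X,\Sigma,\mu)$ be a $\sigma$-finite measure space and let $\omega:X\to\mathbb{R}$ be measurable with $\omega\ge m$ almost everywhere for some $m>0$. Let $\mathcal{F}=\bigoplus_{n\ge 0}S_nL^2(X)^{\otimes n}$ be the bosonic Fock space over $L^2(X)$, with creation and annihilation operators $a^*(f),a(f)$, $f\in L^2(X)$, and let $\mathrm{d}\Gamma(\omega)$ be the second quantization of $\omega$, i.e. the self-adjoint operator acting on the $n$-boson sector as multiplication by $\omega(k_1)+\dots+\omega(k_n)$. Let $D\in\mathbb{N}$ and $\mathfrak{H}=\mathbb{C}^D\otimes\mathcal{F}$. Let $K\in\mathbb{C}^{D\times D}$ be Hermitian and let $B\in\mathbb{C}^{D\times D}$ be unitary, and assume that there is an orthonormal basis $(v_k)_{k=1}^D$ of $\mathbb{C}^D$ consisting of eigenvectors of $K$ such that for every $1\le k\le D$ there is some $1\le k'\le D$ with $Bv_k=v_{k'}$. Let $(f_\Lambda)_{\Lambda\in\mathbb{N}}\subset L^2(X)$ satisfy $\Vert\omega^{-1}f_\Lambda\Vert_{L^2}\to\infty$ as $\Lambda\to\infty$, and put $$H_\Lambda:=K\otimes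 1+1\otimes\mathrm{d}\Gamma(\omega)+B\otimes a^*(f_\Lambda)+B^*\otimes a(f_\Lambda)\quad\text{on }\mathbb{C}^D\otimes\operatorname{Dom}(\mathrm{d}\Gamma(\omega)),\qquad E_\Lambda:=-B^*B\int_X\frac{|f_\Lambda(k)|^2}{\omega(k)}\,\mathrm{d}\mu(k).$$ Then there exist a real diagonal matrix $\eta_0\in\mathbb{C}^{D\times D}$ and unitary operators $W_\Lambda:\mathfrak{H}\to\mathfrak{H}$, $\Lambda\in\mathbb{N}$, such that $$W_\Lambda\,(H_\Lambda-E_\Lambda\otimes 1)\,W_\Lambda^*\;\longrightarrow\;\eta_0\otimes 1+1\otimes\mathrm{d}\Gamma(\omega)\qquad\text{as }\Lambda\to\infty$$ in the norm resolvent sense: all these operators are self-adjoint, and for every $z\in\mathbb{C}\setminus\mathbb{R}$ their resolvents at $z$ converge in operator norm. -/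

import Mathlib

open MeasureTheory Filter Topology
open scoped ENNReal

noncomputable section

namespace GSB

/-! ### The bosonic Fock space over `L²(X, μ)` -/

section Fock

variable {X : Type*} [MeasurableSpace X] (μ : Measure X) [SigmaFinite μ]

/-- The unsymmetrized `n`-boson space `L²(Xⁿ, μⁿ) = L²(X, μ)^{⊗ n}`. -/
abbrev NBody (n : ℕ) : Type _ := Lp ℂ 2 (Measure.pi (fun _ : Fin n => μ))

theorem measurePreserving_perm (n : ℕ) (σ : Equiv.Perm (Fin n)) :
    MeasurePreserving (fun k : Fin n → X => fun i => k (σ i))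
      (Measure.pi (fun _ : Fin n => μ)) (Measure.pi (fun _ : Fin n => μ)) := by
  have h := measurePreserving_piCongrLeft (fun _ : Fin n => μ) σ.symm
  convert! h using 1
  funext k i
  have := MeasurableEquiv.piCongrLeft_apply_apply (β := fun _ : Fin n => X) σ.symm k (σ i)
  simpa using this.symm

/-- The `n`-boson space `S_n L²(X, μ)^{⊗ n}`: the permutation-symmetric elements of
`L²(Xⁿ, μⁿ)`. -/
def symSpace (n : ℕ) : Submodule ℂ (NBody μ n) where
  carrier := {ψ | ∀ σ : Equiv.Perm (Fin n),
    (fun k : Fin n → X => ψ (fun i => k (σ i))) =ᵐ[Measure.pi (fun _ : Fin n => μ)] ψ}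
  zero_mem' := fun σ => by
    have h := Lp.coeFn_zero ℂ 2 (Measure.pi (fun _ : Fin n => μ))
    have h' := (measurePreserving_perm μ n σ).quasiMeasurePreserving.ae h
    filter_upwards [h, h'] with k hk hk'
    rw [hk, hk']
    rfl
  add_mem' := fun {a b} ha hb σ => by
    have h := Lp.coeFn_add a b
    have h' := (measurePreserving_perm μ n σ).quasiMeasurePreserving.ae h
    filter_upwards [h, h', ha σ, hb σ] with k hk hk' h1 h2
    rw [hk, hk', Pi.add_apply, Pi.add_apply, h1, h2]
  smul_mem' := fun c a ha σ => by
    have h := Lp.coeFn_smul c a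
    have h' := (measurePreserving_perm μ n σ).quasiMeasurePreserving.ae h
    filter_upwards [h, h', ha σ] with k hk hk' h1
    rw [hk, hk', Pi.smul_apply, Pi.smul_apply, h1]

theorem isClosed_symSpace (n : ℕ) : IsClosed (symSpace μ n : Set (NBody μ n)) := by
  have : (symSpace μ n : Set (NBody μ n)) = ⋂ σ : Equiv.Perm (Fin n),
      {ψ | Lp.compMeasurePreserving _ (measurePreserving_perm μ n σ) ψ = ψ} := by
    ext ψ
    simp only [Set.mem_iInter, Set.mem_ofPred_eq]
    refine forall_congr' fun σ => ?_
    have h := Lp.coeFn_compMeasurePreserving ψ (measurePreserving_perm μ n σ)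
    constructor
    · intro hψ
      exact Lp.ext (h.trans hψ)
    · intro hψ
      rw [hψ] at h
      exact h.symm
  rw [this]
  exact isClosed_iInter fun σ =>
    isClosed_eq (Lp.isometry_compMeasurePreserving _).continuous continuous_id

instance instCompleteSpaceSymSpace (n : ℕ) : CompleteSpace (symSpace μ n) :=
  (isClosed_symSpace μ n).completeSpace_coe

/-- The bosonic Fock space over `L²(X, μ)`: the Hilbert space direct sum of all `n`-boson
spaces. -/
abbrev Fock : Type _ := lp (fun n : ℕ => symSpace μ n) 2

theorem memℓp_two_iff {E : ℕ → Type*} [∀ n, NormedAddCommGroup (E n)] (ψ : ∀ n, E n) :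
    Memℓp ψ 2 ↔ Summable fun n => ‖ψ n‖ ^ 2 := by
  rw [memℓp_gen_iff (by norm_num)]
  simp

/-! ### Second quantization of the dispersion relation -/

/-- The graph of `dΓ(ω)`: all pairs `(ψ, φ)` of Fock vectors with
`φ⁽ⁿ⁾(k₁, …, kₙ) = (ω(k₁) + ⋯ + ω(kₙ)) ψ⁽ⁿ⁾(k₁, …, kₙ)` for all `n`. -/
def dGammaGraph (ω : X → ℝ) : Submodule ℂ (Fock μ × Fock μ) where
  carrier := {p | ∀ n : ℕ, ((p.2 n : NBody μ n) : (Fin n → X) → ℂ)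
    =ᵐ[Measure.pi (fun _ : Fin n => μ)]
      fun k => ((∑ j, ω (k j) : ℝ) : ℂ) * (p.1 n : NBody μ n) k}
  zero_mem' := fun n => by
    have h := Lp.coeFn_zero ℂ 2 (Measure.pi (fun _ : Fin n => μ))
    filter_upwards [h] with k hk
    have e : (((0 : Fock μ × Fock μ).1 n : symSpace μ n) : NBody μ n) = 0 := rfl
    have e' : (((0 : Fock μ × Fock μ).2 n : symSpace μ n) : NBody μ n) = 0 := rfl
    rw [e, e', hk]
    simp
  add_mem' := fun {p q} hp hq n => by
    have h1 := Lp.coeFn_add (p.1 n : NBody μ n) (q.1 n : NBody μ n)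
    have h2 := Lp.coeFn_add (p.2 n : NBody μ n) (q.2 n : NBody μ n)
    filter_upwards [h1, h2, hp n, hq n] with k h1 h2 h3 h4
    have e : (((p + q).1 n : symSpace μ n) : NBody μ n) = (p.1 n : NBody μ n) + (q.1 n) := rfl
    have e' : (((p + q).2 n : symSpace μ n) : NBody μ n) = (p.2 n : NBody μ n) + (q.2 n) := rfl
    rw [e, e', h1, h2, Pi.add_apply, Pi.add_apply, h3, h4]
    ring
  smul_mem' := fun c p hp n => by
    have h1 := Lp.coeFn_smul c (p.1 n : NBody μ n)
    have h2 := Lp.coeFn_smul c (p.2 n : NBody μ n)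
    filter_upwards [h1, h2, hp n] with k h1 h2 h3
    have e : (((c • p).1 n : symSpace μ n) : NBody μ n) = c • (p.1 n : NBody μ n) := rfl
    have e' : (((c • p).2 n : symSpace μ n) : NBody μ n) = c • (p.2 n : NBody μ n) := rfl
    rw [e, e', h1, h2, Pi.smul_apply, Pi.smul_apply, h3]
    simp only [smul_eq_mul]
    ring

/-- `dΓ(ω)` on its maximal domain, i.e. on all `ψ` for which the sectors
`(ω(k₁) + ⋯ + ω(kₙ)) ψ⁽ⁿ⁾` form a vector of the Fock space. -/
def dGamma (ω : X → ℝ) : Fock μ →ₗ.[ℂ] Fock μ := (dGammaGraph μ ω).toLinearPMap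

/-- The graph above is single-valued, so `dGamma` has exactly this graph. -/
theorem dGamma_graph (ω : X → ℝ) : (dGamma μ ω).graph = dGammaGraph μ ω := by
  refine Submodule.toLinearPMap_graph_eq _ fun p hp hp0 => ?_
  apply lp.ext
  funext n
  apply Subtype.ext
  apply Lp.ext
  have h := Lp.coeFn_zero ℂ 2 (Measure.pi (fun _ : Fin n => μ))
  filter_upwards [hp n, h] with k hk h0
  rw [hk, hp0]
  have e : (((0 : Fock μ) n : symSpace μ n) : NBody μ n) = 0 := rfl
  rw [e, h0]
  simp

/-! ### Creation and annihilation operators -/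

variable {μ}

theorem memLp_tensor (f : Lp ℂ 2 μ) (n : ℕ) (j : Fin (n + 1)) (ψ : NBody μ n) :
    MemLp (fun k : Fin (n + 1) → X => f (k j) * ψ (fun i => k (j.succAbove i))) 2
      (Measure.pi (fun _ : Fin (n + 1) => μ)) ∧
    eLpNorm (fun k : Fin (n + 1) → X => f (k j) * ψ (fun i => k (j.succAbove i))) 2
      (Measure.pi (fun _ : Fin (n + 1) => μ)) = ‖f‖ₑ * ‖ψ‖ₑ := by
  have hmp := measurePreserving_piFinSuccAbove (fun _ : Fin (n + 1) => μ) j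
  have hf := Lp.aestronglyMeasurable f
  have hψ := Lp.aestronglyMeasurable ψ
  set g : X × (Fin n → X) → ℂ := fun p => f p.1 * ψ p.2 with hg
  have hgm : AEStronglyMeasurable g (μ.prod (Measure.pi (fun _ : Fin n => μ))) :=
    (hf.comp_fst).mul (hψ.comp_snd)
  have hgn : eLpNorm g 2 (μ.prod (Measure.pi (fun _ : Fin n => μ))) = ‖f‖ₑ * ‖ψ‖ₑ := by
    rw [Lp.enorm_def, Lp.enorm_def]
    simp only [eLpNorm_eq_lintegral_rpow_enorm_toReal (two_ne_zero) (ENNReal.ofNat_ne_top)]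
    rw [← ENNReal.mul_rpow_of_nonneg _ _ (by positivity)]
    congr 1
    rw [← lintegral_prod_mul (hf.enorm.pow_const _) (hψ.enorm.pow_const _)]
    refine lintegral_congr fun p => ?_
    rw [hg]
    simp only [enorm_mul]
    rw [ENNReal.mul_rpow_of_nonneg _ _ (by positivity)]
  have hgL : MemLp g 2 (μ.prod (Measure.pi (fun _ : Fin n => μ))) :=
    ⟨hgm, by rw [hgn]; exact ENNReal.mul_lt_top enorm_lt_top enorm_lt_top⟩
  have e : (fun k : Fin (n + 1) → X => f (k j) * ψ (fun i => k (j.succAbove i)))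
      = g ∘ (MeasurableEquiv.piFinSuccAbove (fun _ : Fin (n + 1) => X) j) := rfl
  rw [e]
  exact ⟨hgL.comp_measurePreserving hmp, by rw [eLpNorm_comp_measurePreserving hgm hmp, hgn]⟩

theorem quasiMeasurePreserving_succAbove (n : ℕ) (j : Fin (n + 1)) :
    Measure.QuasiMeasurePreserving (fun k : Fin (n + 1) → X => fun i => k (j.succAbove i))
      (Measure.pi (fun _ : Fin (n + 1) => μ)) (Measure.pi (fun _ : Fin n => μ)) :=
  Measure.quasiMeasurePreserving_snd.comp
    (measurePreserving_piFinSuccAbove (fun _ : Fin (n + 1) => μ) j).quasiMeasurePreserving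

/-- The map `ψ ↦ f(k_j) ψ(k₁, …, k_{j-1}, k_{j+1}, …, k_{n+1})` from `L²(Xⁿ)` to `L²(Xⁿ⁺¹)`. -/
def insertAt (f : Lp ℂ 2 μ) (n : ℕ) (j : Fin (n + 1)) : NBody μ n →L[ℂ] NBody μ (n + 1) :=
  LinearMap.mkContinuous
    { toFun := fun ψ => (memLp_tensor f n j ψ).1.toLp _
      map_add' := fun ψ φ => by
        rw [← MemLp.toLp_add]
        apply MemLp.toLp_congr
        have h := (quasiMeasurePreserving_succAbove (μ := μ) n j).ae (Lp.coeFn_add ψ φ)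
        filter_upwards [h] with k hk
        rw [Pi.add_apply, hk, Pi.add_apply]
        ring
      map_smul' := fun c ψ => by
        rw [RingHom.id_apply, ← MemLp.toLp_const_smul]
        apply MemLp.toLp_congr
        have h := (quasiMeasurePreserving_succAbove (μ := μ) n j).ae (Lp.coeFn_smul c ψ)
        filter_upwards [h] with k hk
        rw [Pi.smul_apply, hk, Pi.smul_apply]
        simp only [smul_eq_mul]
        ring }
    ‖f‖ (fun ψ => by
      change ‖(memLp_tensor f n j ψ).1.toLp _‖ ≤ _
      rw [Lp.norm_toLp, (memLp_tensor f n j ψ).2, ENNReal.toReal_mul, toReal_enorm, toReal_enorm])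

theorem coeFn_insertAt (f : Lp ℂ 2 μ) (n : ℕ) (j : Fin (n + 1)) (ψ : NBody μ n) :
    insertAt f n j ψ =ᵐ[Measure.pi (fun _ : Fin (n + 1) => μ)]
      fun k => f (k j) * ψ (fun i => k (j.succAbove i)) :=
  MemLp.coeFn_toLp (memLp_tensor f n j ψ).1

theorem norm_insertAt_le (f : Lp ℂ 2 μ) (n : ℕ) (j : Fin (n + 1)) : ‖insertAt f n j‖ ≤ ‖f‖ :=
  LinearMap.mkContinuous_norm_le _ (norm_nonneg _) _

/-- `(n+1)^{-1/2} ∑_j f(k_j) ψ(k₁, …, k_{j-1}, k_{j+1}, …, k_{n+1})`; for symmetric `ψ` this is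
`√(n+1) S_{n+1} (f ⊗ ψ)`. -/
def createAux (f : Lp ℂ 2 μ) (n : ℕ) : NBody μ n →L[ℂ] NBody μ (n + 1) :=
  ((Real.sqrt (n + 1) : ℂ)⁻¹) • ∑ j : Fin (n + 1), insertAt f n j

theorem norm_createAux_le (f : Lp ℂ 2 μ) (n : ℕ) :
    ‖createAux f n‖ ≤ Real.sqrt (n + 1) * ‖f‖ := by
  have hpos : (0 : ℝ) < n + 1 := by positivity
  have h1 : ‖∑ j : Fin (n + 1), insertAt f n j‖ ≤ (n + 1) * ‖f‖ := by
    refine (norm_sum_le _ _).trans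
      ((Finset.sum_le_sum fun j _ => norm_insertAt_le f n j).trans (le_of_eq ?_))
    simp
  have h2 : ‖((Real.sqrt (n + 1) : ℂ)⁻¹)‖ = (Real.sqrt (n + 1))⁻¹ := by
    rw [norm_inv, Complex.norm_real, Real.norm_of_nonneg (Real.sqrt_nonneg _)]
  unfold createAux
  rw [norm_smul, h2]
  calc (Real.sqrt (n + 1))⁻¹ * ‖∑ j : Fin (n + 1), insertAt f n j‖
      ≤ (Real.sqrt (n + 1))⁻¹ * ((n + 1) * ‖f‖) := by gcongr
    _ = (Real.sqrt (n + 1))⁻¹ * ((Real.sqrt (n + 1) * Real.sqrt (n + 1)) * ‖f‖) := by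
        rw [Real.mul_self_sqrt hpos.le]
    _ = Real.sqrt (n + 1) * ‖f‖ := by
        have := (Real.sqrt_pos.2 hpos).ne'
        field_simp

theorem coeFn_createAux (f : Lp ℂ 2 μ) (n : ℕ) (ψ : NBody μ n) :
    createAux f n ψ =ᵐ[Measure.pi (fun _ : Fin (n + 1) => μ)]
      fun k => (Real.sqrt (n + 1) : ℂ)⁻¹ *
        ∑ j, f (k j) * ψ (fun i => k (j.succAbove i)) := by
  have e : createAux f n ψ
      = ((Real.sqrt (n + 1) : ℂ)⁻¹) • ∑ j : Fin (n + 1), insertAt f n j ψ := by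
    simp [createAux]
  rw [e]
  have h1 := Lp.coeFn_smul ((Real.sqrt (n + 1) : ℂ)⁻¹) (∑ j : Fin (n + 1), insertAt f n j ψ)
  have h2 := Lp.coeFn_finsetSum Finset.univ (fun j : Fin (n + 1) => insertAt f n j ψ)
  have h3 := ae_all_iff.2 fun j : Fin (n + 1) => coeFn_insertAt f n j ψ
  filter_upwards [h1, h2, h3] with k h1 h2 h3
  rw [h1, Pi.smul_apply, h2]
  simp [h3]

theorem exists_perm_succAbove (n : ℕ) (σ : Equiv.Perm (Fin (n + 1))) (j : Fin (n + 1)) :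
    ∃ τ : Equiv.Perm (Fin n), ∀ i, σ (j.succAbove i) = (σ j).succAbove (τ i) := by
  have h : ∀ i, ∃ t, (σ j).succAbove t = σ (j.succAbove i) := fun i =>
    Fin.exists_succAbove_eq (fun h => Fin.succAbove_ne j i (σ.injective h))
  choose t ht using h
  have hinj : Function.Injective t := fun a b hab => by
    have : σ (j.succAbove a) = σ (j.succAbove b) := by rw [← ht a, ← ht b, hab]
    exact Fin.succAbove_right_injective (σ.injective this)
  exact ⟨Equiv.ofBijective t (Finite.injective_iff_bijective.1 hinj), fun i => (ht i).symm⟩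

theorem createAux_mem (f : Lp ℂ 2 μ) (n : ℕ) (ψ : symSpace μ n) :
    createAux f n ψ ∈ symSpace μ (n + 1) := by
  intro σ
  have h := coeFn_createAux f n (ψ : NBody μ n)
  have h' := (measurePreserving_perm μ (n + 1) σ).quasiMeasurePreserving.ae h
  choose τ hτ using exists_perm_succAbove n σ
  have hs := ae_all_iff.2 fun j : Fin (n + 1) =>
    (quasiMeasurePreserving_succAbove (μ := μ) n (σ j)).ae (ψ.2 (τ j))
  filter_upwards [h, h', hs] with k hk hk' hs
  rw [hk, hk']
  congr 1
  rw [← Equiv.sum_comp σ (fun j => f (k j) * (ψ : NBody μ n) (fun i => k (j.succAbove i)))]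
  refine Finset.sum_congr rfl fun j _ => ?_
  rw [← hs j]
  simp only [hτ]

/-- The creation operator `a*(f)` between the `n`- and the `(n+1)`-boson space,
`(a*(f) ψ)(k₁, …, k_{n+1}) = (n+1)^{-1/2} ∑_j f(k_j) ψ(k₁, …, k_{j-1}, k_{j+1}, …, k_{n+1})`. -/
def createSector (f : Lp ℂ 2 μ) (n : ℕ) : symSpace μ n →L[ℂ] symSpace μ (n + 1) :=
  ((createAux f n).comp (symSpace μ n).subtypeL).codRestrict (symSpace μ (n + 1))
    (fun ψ => createAux_mem f n ψ)

/-- The annihilation operator `a(f)` between the `(n+1)`- and the `n`-boson space: the adjoint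
of the creation operator. -/
def annihilateSector (f : Lp ℂ 2 μ) (n : ℕ) : symSpace μ (n + 1) →L[ℂ] symSpace μ n :=
  ContinuousLinearMap.adjoint (createSector f n)

theorem norm_createSector_le (f : Lp ℂ 2 μ) (n : ℕ) :
    ‖createSector f n‖ ≤ Real.sqrt (n + 1) * ‖f‖ := by
  refine ContinuousLinearMap.opNorm_le_bound _ (by positivity) fun ψ => ?_
  change ‖createAux f n (ψ : NBody μ n)‖ ≤ _
  exact (createAux f n).le_of_opNorm_le (norm_createAux_le f n) _

theorem norm_annihilateSector_le (f : Lp ℂ 2 μ) (n : ℕ) :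
    ‖annihilateSector f n‖ ≤ Real.sqrt (n + 1) * ‖f‖ := by
  unfold annihilateSector
  rw [LinearIsometryEquiv.norm_map]
  exact norm_createSector_le f n

variable (μ) in
/-- The domain of `𝒩^{1/2}`, where `𝒩` is the number operator. -/
def domSqrtNumber : Submodule ℂ (Fock μ) where
  carrier := {ψ | Summable fun n : ℕ => (n : ℝ) * ‖ψ n‖ ^ 2}
  zero_mem' := by
    change Summable fun n : ℕ => (n : ℝ) * ‖(0 : Fock μ) n‖ ^ 2
    simp
  add_mem' := fun {a b} ha hb => by
    have ha' : Summable fun n : ℕ => (n : ℝ) * ‖a n‖ ^ 2 := ha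
    have hb' : Summable fun n : ℕ => (n : ℝ) * ‖b n‖ ^ 2 := hb
    change Summable fun n : ℕ => (n : ℝ) * ‖a n + b n‖ ^ 2
    refine Summable.of_nonneg_of_le (fun n => by positivity) (fun n => ?_)
      ((ha'.mul_left 2).add (hb'.mul_left 2))
    have h1 : ‖a n + b n‖ ^ 2 ≤ 2 * ‖a n‖ ^ 2 + 2 * ‖b n‖ ^ 2 := by
      have := norm_add_le (a n) (b n)
      nlinarith [sq_nonneg (‖a n‖ - ‖b n‖), norm_nonneg (a n + b n)]
    calc (n : ℝ) * ‖a n + b n‖ ^ 2 ≤ n * (2 * ‖a n‖ ^ 2 + 2 * ‖b n‖ ^ 2) := by gcongr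
      _ = _ := by ring
  smul_mem' := fun c a ha => by
    have ha' : Summable fun n : ℕ => (n : ℝ) * ‖a n‖ ^ 2 := ha
    change Summable fun n : ℕ => (n : ℝ) * ‖c • a n‖ ^ 2
    refine (ha'.mul_left (‖c‖ ^ 2)).congr fun n => ?_
    rw [norm_smul]
    ring

/-- The sectors of `a*(f) ψ`: nothing in the vacuum sector, `a*(f) ψ⁽ⁿ⁾` in the `(n+1)`-boson
sector. -/
def createSeq (f : Lp ℂ 2 μ) (ψ : Fock μ) : ∀ n : ℕ, symSpace μ n
  | 0 => 0
  | n + 1 => createSector f n (ψ n)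

theorem sq_le_of_le_sqrt {a b c x : ℝ} (ha : 0 ≤ a) (hx : 0 ≤ x)
    (h : x ≤ Real.sqrt a * b * c) : x ^ 2 ≤ b ^ 2 * (a * c ^ 2) := by
  calc x ^ 2 ≤ (Real.sqrt a * b * c) ^ 2 := by gcongr
    _ = (Real.sqrt a) ^ 2 * b ^ 2 * c ^ 2 := by ring
    _ = b ^ 2 * (a * c ^ 2) := by rw [Real.sq_sqrt ha]; ring

theorem memℓp_createSeq (f : Lp ℂ 2 μ) (ψ : domSqrtNumber μ) :
    Memℓp (createSeq f (ψ : Fock μ)) 2 := by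
  rw [memℓp_two_iff, ← summable_nat_add_iff 1]
  have h1 : Summable fun n : ℕ => (n : ℝ) * ‖(ψ : Fock μ) n‖ ^ 2 := ψ.2
  have h2 : Summable fun n : ℕ => ‖(ψ : Fock μ) n‖ ^ 2 := (memℓp_two_iff _).1 (lp.memℓp _)
  refine Summable.of_nonneg_of_le (fun n => by positivity) (fun n => ?_)
    ((h1.add h2).mul_left (‖f‖ ^ 2))
  have h3 : ‖createSeq f (ψ : Fock μ) (n + 1)‖
      ≤ Real.sqrt (n + 1) * ‖f‖ * ‖(ψ : Fock μ) n‖ :=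
    (createSector f n).le_of_opNorm_le (norm_createSector_le f n) _
  have h4 := sq_le_of_le_sqrt (by positivity) (norm_nonneg _) h3
  linarith

theorem memℓp_annihilateSeq (f : Lp ℂ 2 μ) (ψ : domSqrtNumber μ) :
    Memℓp (fun n : ℕ => annihilateSector f n ((ψ : Fock μ) (n + 1))) 2 := by
  rw [memℓp_two_iff]
  have h1 : Summable fun n : ℕ => (n : ℝ) * ‖(ψ : Fock μ) n‖ ^ 2 := ψ.2
  refine Summable.of_nonneg_of_le (fun n => by positivity) (fun n => ?_)
    (((summable_nat_add_iff 1).2 h1).mul_left (‖f‖ ^ 2))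
  have h3 : ‖annihilateSector f n ((ψ : Fock μ) (n + 1))‖
      ≤ Real.sqrt (n + 1) * ‖f‖ * ‖(ψ : Fock μ) (n + 1)‖ :=
    (annihilateSector f n).le_of_opNorm_le (norm_annihilateSector_le f n) _
  have h4 := sq_le_of_le_sqrt (by positivity) (norm_nonneg _) h3
  push_cast
  exact h4

/-- The creation operator `a*(f)` with domain `Dom(𝒩^{1/2})`. -/
def create (f : Lp ℂ 2 μ) : Fock μ →ₗ.[ℂ] Fock μ where
  domain := domSqrtNumber μ
  toFun :=
    { toFun := fun ψ => ⟨createSeq f (ψ : Fock μ), memℓp_createSeq f ψ⟩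
      map_add' := fun ψ φ => by
        apply lp.ext
        funext n
        cases n with
        | zero => exact (add_zero (0 : symSpace μ 0)).symm
        | succ n => exact map_add (createSector f n) ((ψ : Fock μ) n) ((φ : Fock μ) n)
      map_smul' := fun c ψ => by
        apply lp.ext
        funext n
        cases n with
        | zero => exact (smul_zero (A := symSpace μ 0) c).symm
        | succ n => exact map_smul (createSector f n) c ((ψ : Fock μ) n) }

/-- The annihilation operator `a(f)` with domain `Dom(𝒩^{1/2})`. -/
def annihilate (f : Lp ℂ 2 μ) : Fock μ →ₗ.[ℂ] Fock μ where
  domain := domSqrtNumber μ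
  toFun :=
    { toFun := fun ψ => ⟨fun n => annihilateSector f n ((ψ : Fock μ) (n + 1)),
        memℓp_annihilateSeq f ψ⟩
      map_add' := fun ψ φ => by
        apply lp.ext
        funext n
        exact map_add (annihilateSector f n) ((ψ : Fock μ) (n + 1)) ((φ : Fock μ) (n + 1))
      map_smul' := fun c ψ => by
        apply lp.ext
        funext n
        exact map_smul (annihilateSector f n) c ((ψ : Fock μ) (n + 1)) }

end Fock

/-! ### Unbounded operators -/

section Operators

variable {F : Type*} [NormedAddCommGroup F] [InnerProductSpace ℂ F]

/-- The Hilbert space `ℂ^D ⊗ F`, as the space of `D`-tuples `Ψ = ∑_i e_i ⊗ Ψ_i` of vectors of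
`F` with norm `‖Ψ‖² = ∑_i ‖Ψ_i‖²`. -/
abbrev Spin (D : ℕ) (F : Type*) : Type _ := PiLp 2 (fun _ : Fin D => F)

/-- `M ⊗ A` on `ℂ^D ⊗ Dom(A)`: its `i`-th component on `Ψ = ∑_j e_j ⊗ Ψ_j` is
`∑_j M_{ij} A Ψ_j`. -/
def spinTensor {D : ℕ} (M : Matrix (Fin D) (Fin D) ℂ) (A : F →ₗ.[ℂ] F) :
    Spin D F →ₗ.[ℂ] Spin D F where
  domain :=
    { carrier := {Ψ | ∀ j, Ψ j ∈ A.domain}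
      zero_mem' := fun _ => A.domain.zero_mem
      add_mem' := fun ha hb j => A.domain.add_mem (ha j) (hb j)
      smul_mem' := fun c _ ha j => A.domain.smul_mem c (ha j) }
  toFun :=
    { toFun := fun Ψ => WithLp.toLp 2 fun i => ∑ j, M i j • A ⟨(Ψ : Spin D F) j, Ψ.2 j⟩
      map_add' := fun Ψ Φ => by
        ext i
        simp only [PiLp.add_apply]
        rw [← Finset.sum_add_distrib]
        refine Finset.sum_congr rfl fun j _ => ?_
        rw [← smul_add, ← LinearPMap.map_add]
        rfl
      map_smul' := fun c Ψ => by
        ext i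
        simp only [PiLp.smul_apply, RingHom.id_apply]
        rw [Finset.smul_sum]
        refine Finset.sum_congr rfl fun j _ => ?_
        rw [smul_comm c, ← LinearPMap.map_smul A c]
        rfl }

/-- The identity, as an everywhere defined operator. -/
def idOp (F : Type*) [NormedAddCommGroup F] [InnerProductSpace ℂ F] : F →ₗ.[ℂ] F :=
  (LinearMap.id : F →ₗ[ℂ] F).toPMap ⊤

/-- The conjugated operator `W A W*` with domain `W Dom(A)`, for `W` unitary. -/
def conj (W : F ≃ₗᵢ[ℂ] F) (A : F →ₗ.[ℂ] F) : F →ₗ.[ℂ] F where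
  domain := A.domain.comap (W.symm.toLinearEquiv : F →ₗ[ℂ] F)
  toFun :=
    { toFun := fun Ψ => W (A ⟨W.symm Ψ, Ψ.2⟩)
      map_add' := fun Ψ Φ => by
        rw [← map_add, ← LinearPMap.map_add]
        congr 2
        exact Subtype.ext (map_add W.symm (Ψ : F) Φ)
      map_smul' := fun c Ψ => by
        rw [RingHom.id_apply, ← map_smul, ← LinearPMap.map_smul]
        congr 2
        exact Subtype.ext (map_smul W.symm c (Ψ : F)) }

/-- `R = (A - z)⁻¹`: the bounded everywhere defined operator `R` is a two-sided inverse of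
`A - z : Dom(A) → F`. -/
def IsResolvent (A : F →ₗ.[ℂ] F) (z : ℂ) (R : F →L[ℂ] F) : Prop :=
  (∀ φ : F, ∃ h : R φ ∈ A.domain, A ⟨R φ, h⟩ - z • R φ = φ) ∧
    ∀ ψ : A.domain, R (A ψ - z • (ψ : F)) = ψ

/-- Norm resolvent convergence `A_Λ → A` of self-adjoint operators:
`(A_Λ - z)⁻¹ → (A - z)⁻¹` in operator norm for every non-real `z`. -/
def NormResolventTendsto [CompleteSpace F] (A : ℕ → F →ₗ.[ℂ] F) (A' : F →ₗ.[ℂ] F) : Prop :=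
  (∀ Λ, IsSelfAdjoint (A Λ)) ∧ IsSelfAdjoint A' ∧
    ∀ z : ℂ, z.im ≠ 0 → ∃ (R : ℕ → F →L[ℂ] F) (R' : F →L[ℂ] F),
      (∀ Λ, IsResolvent (A Λ) z (R Λ)) ∧ IsResolvent A' z R' ∧ Tendsto R atTop (𝓝 R')

end Operators

/-! ### The generalized spin–boson model with one form factor -/

section Model

variable {X : Type*} [MeasurableSpace X] {μ : Measure X} [SigmaFinite μ] {D : ℕ}

/-- The Hamiltonian `H = K ⊗ 1 + 1 ⊗ dΓ(ω) + B ⊗ a*(f) + B* ⊗ a(f)` on `ℂ^D ⊗ ℱ`, on the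
intersection of the domains of its summands (for `ω ≥ m > 0` this is `ℂ^D ⊗ Dom(dΓ(ω))`). -/
def hamiltonian (ω : X → ℝ) (K B : Matrix (Fin D) (Fin D) ℂ) (f : Lp ℂ 2 μ) :
    Spin D (Fock μ) →ₗ.[ℂ] Spin D (Fock μ) :=
  spinTensor K (idOp (Fock μ)) + spinTensor 1 (dGamma μ ω)
    + (spinTensor B (create f) + spinTensor B.conjTranspose (annihilate f))

/-- The self-energy `E = -B* B ∫ conj(f(k)) f(k) / ω(k) dμ(k)`, a `D × D` matrix. -/
def selfEnergy (ω : X → ℝ) (B : Matrix (Fin D) (Fin D) ℂ) (f : Lp ℂ 2 μ) :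
    Matrix (Fin D) (Fin D) ℂ :=
  -((∫ k, (starRingEnd ℂ) (f k) * f k / (ω k : ℂ) ∂μ) • (B.conjTranspose * B))

/-- `B` is unitary and permutes some orthonormal eigenbasis of `K`. -/
def PermutesEigenbasis (K B : Matrix (Fin D) (Fin D) ℂ) : Prop :=
  B ∈ Matrix.unitaryGroup (Fin D) ℂ ∧
    ∃ v : OrthonormalBasis (Fin D) ℂ (EuclideanSpace ℂ (Fin D)),
      (∀ i, ∃ c : ℂ, Matrix.toEuclideanLin K (v i) = c • v i) ∧
        ∀ i, ∃ i', Matrix.toEuclideanLin B (v i) = v i'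

end Model

end GSB

end

/-!
Let `W(g) = e^{a*(g) - a(g)}` denote the Weyl operators. Conjugation with `W(ω⁻¹f)` turns
`dΓ(ω) + a*(f) + a(f) + ∫ |f|² / ω` into `dΓ(ω)`. Since `B` is normal, there is an orthonormal basis
of `ℂ^D` consisting of eigenvectors of `B`, and within each eigenspace of `B` it can be chosen so as
to diagonalise the compression of `K`. If `β₁, …, β_D` are the eigenvalues, then in this basis the
dressing transformation `⨁ⱼ W(βⱼg)` with `g = ω⁻¹f` turns `H - E` into `dΓ(ω)` plus the bounded
operator with entries `K_{jk} W(βⱼg) W(β_kg)*`. The diagonal entries are constant and form `η₀`, and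
the other entries with `βⱼ = β_k` vanish. For `βⱼ ≠ β_k`, the operator `U = W(βⱼg) W(β_kg)*`
satisfies `a(g) U = U (a(g) + (βⱼ - β_k) ‖g‖²)`. As `a(g)` and `a*(g)` are bounded by `‖g‖` relative
to `dΓ(ω)`, because `ω ≥ m`, this makes `U` of order `1 / ‖g‖` as a quadratic form on the domain of
`dΓ(ω)`. Finally, the resolvent maps into that domain, so bounded perturbations which tend to zero
as such quadratic forms disappear in the limit in the norm resolvent sense.
-/

noncomputable section

namespace GSB

section SelfAdjoint

variable {𝕜 F : Type*} [RCLike 𝕜] [NormedAddCommGroup F] [InnerProductSpace 𝕜 F]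

theorem mem_adjoint_iff_inner_eq {G : Submodule 𝕜 (F × F)} {x y : F} :
    (x, y) ∈ G.adjoint ↔ ∀ a b, (a, b) ∈ G → inner 𝕜 b x = inner 𝕜 a y := by
  simp only [Submodule.mem_adjoint_iff, sub_eq_zero]

theorem adjoint_eq_self_of_surjective {G : Submodule 𝕜 (F × F)} (hG : G ≤ G.adjoint) (c : ℝ)
    (hs : ∀ φ, ∃ ψ, (ψ, φ - (c : 𝕜) • ψ) ∈ G) : G.adjoint = G := by
  refine le_antisymm (fun ⟨x, y⟩ hxy => ?_) hG
  obtain ⟨ψ, hψ⟩ := hs (y + (c : 𝕜) • x)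
  suffices x = ψ by simpa [← this] using hψ
  refine ext_inner_left 𝕜 fun φ => ?_
  obtain ⟨χ, hχ⟩ := hs φ
  have h₁ := mem_adjoint_iff_inner_eq.1 hxy _ _ hχ
  have h₂ := mem_adjoint_iff_inner_eq.1 (hG hψ) _ _ hχ
  simp only [inner_sub_left, inner_sub_right, inner_add_right, inner_smul_left,
    inner_smul_right, RCLike.conj_ofReal] at h₁ h₂
  linear_combination h₁ - h₂

theorem mem_graph_vadd {V : F →ₗ[𝕜] F} {A : F →ₗ.[𝕜] F} {x y : F} :
    (x, y) ∈ (V +ᵥ A).graph ↔ (x, y - V x) ∈ A.graph := by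
  simp only [LinearPMap.mem_graph_iff]
  refine exists_congr fun a => and_congr_right fun ha => ?_
  rw [← ha, LinearPMap.vadd_apply, eq_sub_iff_add_eq']

variable [CompleteSpace F] {A : F →ₗ.[𝕜] F}

theorem dense_domain_of_adjoint_graph_eq (h : A.graph.adjoint = A.graph) :
    Dense (A.domain : Set F) := by
  rw [Submodule.dense_iff_topologicalClosure_eq_top, Submodule.topologicalClosure_eq_top_iff,
    Submodule.eq_bot_iff]
  intro y hy
  have h0 : ((0 : F), y) ∈ A.graph := h ▸ mem_adjoint_iff_inner_eq.2 fun a b hab => by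
    rw [inner_zero_right, hy a (LinearPMap.mem_domain_of_mem_graph hab)]
  exact LinearPMap.graph_fst_eq_zero_snd A h0 rfl

theorem isSelfAdjoint_iff_adjoint_graph_eq : IsSelfAdjoint A ↔ A.graph.adjoint = A.graph := by
  rw [LinearPMap.isSelfAdjoint_def]
  constructor
  · intro h
    rw [← LinearPMap.adjoint_graph_eq_graph_adjoint
      (IsSelfAdjoint.dense_domain (LinearPMap.isSelfAdjoint_def.2 h)), h]
  · intro h
    exact LinearPMap.eq_of_eq_graph <|
      (LinearPMap.adjoint_graph_eq_graph_adjoint (dense_domain_of_adjoint_graph_eq h)).trans h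

theorem inner_eq_inner_of_mem_graph (hA : IsSelfAdjoint A) {a b x y : F}
    (hab : (a, b) ∈ A.graph) (hxy : (x, y) ∈ A.graph) : inner 𝕜 b x = inner 𝕜 a y := by
  rw [← isSelfAdjoint_iff_adjoint_graph_eq.1 hA] at hxy
  exact mem_adjoint_iff_inner_eq.1 hxy a b hab

theorem isSelfAdjoint_vadd (hA : IsSelfAdjoint A) {V : F →L[𝕜] F} (hV : IsSelfAdjoint V) :
    IsSelfAdjoint ((V : F →ₗ[𝕜] F) +ᵥ A) := by
  rw [isSelfAdjoint_iff_adjoint_graph_eq] at hA ⊢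
  have hsymm : ∀ a x, inner 𝕜 (V a) x = inner 𝕜 a (V x) := hV.isSymmetric
  ext ⟨x, y⟩
  rw [mem_graph_vadd, ← hA, mem_adjoint_iff_inner_eq, mem_adjoint_iff_inner_eq]
  constructor
  · intro hxy a b hab
    have := hxy a (b + V a) (mem_graph_vadd.2 (by simpa using hab))
    rw [inner_add_left, hsymm] at this
    rw [ContinuousLinearMap.coe_coe, inner_sub_right, ← this, add_sub_cancel_right]
  · intro hxy a b hab
    have := hxy _ _ (mem_graph_vadd.1 hab)
    rw [ContinuousLinearMap.coe_coe, inner_sub_left, inner_sub_right, hsymm] at this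
    exact sub_left_injective this

end SelfAdjoint

section Resolvent

variable {F : Type*} [NormedAddCommGroup F] [InnerProductSpace ℂ F] {A : F →ₗ.[ℂ] F} {z : ℂ}
  {R : F →L[ℂ] F}

theorem IsResolvent.mem_graph (h : IsResolvent A z R) (φ : F) : (R φ, φ + z • R φ) ∈ A.graph := by
  obtain ⟨hmem, heq⟩ := h.1 φ
  simpa only [sub_eq_iff_eq_add.1 heq] using A.mem_graph ⟨R φ, hmem⟩

/-- `A - z` as a bounded operator on the graph of `A`; unlike `A - z` on `Dom(A)`, it has a
complete domain when `A` is closed. -/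
def graphSub (A : F →ₗ.[ℂ] F) (z : ℂ) : A.graph →L[ℂ] F :=
  (ContinuousLinearMap.snd ℂ F F - z • ContinuousLinearMap.fst ℂ F F).comp A.graph.subtypeL

theorem graphSub_apply (p : A.graph) : graphSub A z p = (p : F × F).2 - z • (p : F × F).1 := rfl

/-- `V` is bounded by `ε` as a quadratic form with respect to the graph norm of `A`. -/
def GraphFormBound (A : F →ₗ.[ℂ] F) (V : F →L[ℂ] F) (ε : ℝ) : Prop :=
  ∀ a b x y, (a, b) ∈ A.graph → (x, y) ∈ A.graph →
    ‖inner ℂ a (V x)‖ ≤ ε * ((‖a‖ + ‖b‖) * (‖x‖ + ‖y‖))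

theorem GraphFormBound.vadd {V : F →L[ℂ] F} {ε : ℝ} (hV : GraphFormBound A V ε) (hε : 0 ≤ ε)
    (S : F →L[ℂ] F) : GraphFormBound ((S : F →ₗ[ℂ] F) +ᵥ A) V (ε * (1 + ‖S‖) ^ 2) := by
  intro a b x y hab hxy
  have hS (u v : F) : ‖u‖ + ‖v - S u‖ ≤ (1 + ‖S‖) * (‖u‖ + ‖v‖) := by
    have h₁ := norm_sub_le v (S u)
    have h₂ := S.le_opNorm u
    have h₃ := mul_nonneg (norm_nonneg S) (norm_nonneg v)
    linarith
  calc ‖inner ℂ a (V x)‖ ≤ ε * ((‖a‖ + ‖b - S a‖) * (‖x‖ + ‖y - S x‖)) :=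
        hV _ _ _ _ (mem_graph_vadd.1 hab) (mem_graph_vadd.1 hxy)
    _ ≤ ε * (((1 + ‖S‖) * (‖a‖ + ‖b‖)) * ((1 + ‖S‖) * (‖x‖ + ‖y‖))) := by
        gcongr <;> apply hS
    _ = ε * (1 + ‖S‖) ^ 2 * ((‖a‖ + ‖b‖) * (‖x‖ + ‖y‖)) := by ring

variable [CompleteSpace F]

theorem abs_im_mul_norm_le_of_mem_graph (hA : IsSelfAdjoint A) (z : ℂ) {x y : F}
    (h : (x, y) ∈ A.graph) : |z.im| * ‖x‖ ≤ ‖y - z • x‖ := by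
  have hreal : (inner ℂ x y).im = 0 := by
    rw [← Complex.conj_eq_iff_im, inner_conj_symm, inner_eq_inner_of_mem_graph hA h h]
  have him : (inner ℂ x (y - z • x)).im = -(z.im * ‖x‖ ^ 2) := by
    rw [inner_sub_right, inner_smul_right, inner_self_eq_norm_sq_to_K, Complex.sub_im, hreal]
    simp [← Complex.ofReal_pow]
  have hsq : |z.im| * ‖x‖ ^ 2 ≤ ‖x‖ * ‖y - z • x‖ := by
    calc |z.im| * ‖x‖ ^ 2 = |(inner ℂ x (y - z • x)).im| := by
          rw [him, abs_neg, abs_mul, abs_of_nonneg (sq_nonneg ‖x‖)]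
      _ ≤ ‖inner ℂ x (y - z • x)‖ := Complex.abs_im_le_norm _
      _ ≤ ‖x‖ * ‖y - z • x‖ := norm_inner_le_norm _ _
  rcases (norm_nonneg x).eq_or_lt with h0 | hpos
  · simp [← h0]
  · exact le_of_mul_le_mul_left (by linarith) hpos

theorem norm_le_graphSub (hA : IsSelfAdjoint A) (hz : z.im ≠ 0) (p : A.graph) :
    ‖p‖ ≤ (1 + (1 + ‖z‖) * |z.im|⁻¹) * ‖graphSub A z p‖ := by
  have hfst : ‖(p : F × F).1‖ ≤ |z.im|⁻¹ * ‖graphSub A z p‖ := by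
    rw [le_inv_mul_iff₀ (abs_pos.2 hz)]
    exact abs_im_mul_norm_le_of_mem_graph hA z p.2
  have hsnd : ‖(p : F × F).2‖ ≤ ‖graphSub A z p‖ + ‖z‖ * ‖(p : F × F).1‖ := by
    rw [← norm_smul, graphSub_apply]
    simpa using norm_add_le ((p : F × F).2 - z • (p : F × F).1) (z • (p : F × F).1)
  have hmax : ‖p‖ ≤ ‖(p : F × F).1‖ + ‖(p : F × F).2‖ :=
    max_le_add_of_nonneg (norm_nonneg _) (norm_nonneg _)
  calc ‖p‖ ≤ ‖graphSub A z p‖ + (1 + ‖z‖) * ‖(p : F × F).1‖ := by linarith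
    _ ≤ ‖graphSub A z p‖ + (1 + ‖z‖) * (|z.im|⁻¹ * ‖graphSub A z p‖) := by gcongr
    _ = _ := by ring

theorem graphSub_range_orthogonal_eq_bot (hA : IsSelfAdjoint A) (hz : z.im ≠ 0) :
    (graphSub A z).rangeᗮ = ⊥ := by
  refine (Submodule.eq_bot_iff _).2 fun y hy => ?_
  have hgraph : (y, starRingEnd ℂ z • y) ∈ A.graph := by
    rw [← isSelfAdjoint_iff_adjoint_graph_eq.1 hA, mem_adjoint_iff_inner_eq]
    intro a b hab
    have := hy (b - z • a) ⟨⟨(a, b), hab⟩, rfl⟩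
    rw [inner_sub_left, inner_smul_left, sub_eq_zero] at this
    rw [this, inner_smul_right]
  have := abs_im_mul_norm_le_of_mem_graph hA (starRingEnd ℂ z) hgraph
  rw [sub_self, norm_zero, Complex.conj_im, abs_neg] at this
  exact norm_le_zero_iff.1 (nonpos_of_mul_nonpos_right this (abs_pos.2 hz))

theorem graphSub_bijective (hA : IsSelfAdjoint A) (hz : z.im ≠ 0) :
    Function.Bijective (graphSub A z) := by
  have : CompleteSpace A.graph := (IsSelfAdjoint.isClosed hA).completeSpace_coe
  have hanti : AntilipschitzWith (Real.toNNReal (1 + (1 + ‖z‖) * |z.im|⁻¹)) (graphSub A z) :=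
    ContinuousLinearMap.antilipschitz_of_bound _ fun p => by
      rw [Real.coe_toNNReal _ (by positivity)]
      exact norm_le_graphSub hA hz p
  have hclosed : IsClosed ((graphSub A z).range : Set F) :=
    hanti.isClosed_range (graphSub A z).uniformContinuous
  have : CompleteSpace (graphSub A z).range := hclosed.completeSpace_coe
  refine ⟨hanti.injective, LinearMap.range_eq_top.1 ?_⟩
  exact Submodule.orthogonal_eq_bot_iff.1 (graphSub_range_orthogonal_eq_bot hA hz)

theorem exists_isResolvent (hA : IsSelfAdjoint A) (hz : z.im ≠ 0) :
    ∃ R : F →L[ℂ] F, IsResolvent A z R := by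
  let e := LinearEquiv.ofBijective (graphSub A z).toLinearMap (graphSub_bijective hA hz)
  have he : ∀ φ, graphSub A z (e.symm φ) = φ := e.apply_symm_apply
  let R : F →ₗ[ℂ] F := LinearMap.fst ℂ F F ∘ₗ A.graph.subtype ∘ₗ e.symm.toLinearMap
  have hR : ∀ φ, ‖R φ‖ ≤ |z.im|⁻¹ * ‖φ‖ := fun φ => by
    rw [le_inv_mul_iff₀ (abs_pos.2 hz)]
    have := abs_im_mul_norm_le_of_mem_graph hA z (e.symm φ).2
    rwa [← graphSub_apply, he] at this
  refine ⟨R.mkContinuous _ hR, fun φ => ?_, fun ψ => ?_⟩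
  · have hgraph := (e.symm φ).2
    have hdom := LinearPMap.mem_domain_of_mem_graph hgraph
    have hA_eq : (e.symm φ : F × F).2 = A ⟨_, hdom⟩ := (LinearPMap.image_iff hdom).2 hgraph
    exact ⟨hdom, (congrArg (· - z • (e.symm φ : F × F).1) hA_eq.symm).trans (he φ)⟩
  · exact congrArg (fun p : A.graph => (p : F × F).1)
      (e.symm_apply_apply ⟨(ψ, A ψ), A.mem_graph ψ⟩)

theorem IsResolvent.norm_apply_le (hR : IsResolvent A z R) (hA : IsSelfAdjoint A)
    (hz : z.im ≠ 0) (φ : F) : ‖R φ‖ ≤ |z.im|⁻¹ * ‖φ‖ := by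
  rw [le_inv_mul_iff₀ (abs_pos.2 hz)]
  simpa using abs_im_mul_norm_le_of_mem_graph hA z (hR.mem_graph φ)

theorem inner_resolvent_sub {V Rᵥ S : F →L[ℂ] F} (hA : IsSelfAdjoint A)
    (hRᵥ : IsResolvent ((V : F →ₗ[ℂ] F) +ᵥ A) z Rᵥ) (hR : IsResolvent A z R)
    (hS : IsResolvent A (starRingEnd ℂ z) S) (φ ψ : F) :
    inner ℂ φ ((Rᵥ - R) ψ) = -inner ℂ (S φ) (V (Rᵥ ψ)) := by
  have h₁ := inner_eq_inner_of_mem_graph hA (hS.mem_graph φ) (mem_graph_vadd.1 (hRᵥ.mem_graph ψ))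
  have h₂ := inner_eq_inner_of_mem_graph hA (hS.mem_graph φ) (hR.mem_graph ψ)
  simp only [ContinuousLinearMap.coe_coe, inner_sub_right, inner_add_right, inner_add_left,
    inner_smul_left, inner_smul_right, Complex.conj_conj] at h₁ h₂
  rw [sub_apply, inner_sub_right]
  linear_combination h₁ - h₂

theorem IsResolvent.norm_add_norm_le (hR : IsResolvent A z R) (hA : IsSelfAdjoint A)
    (hz : z.im ≠ 0) (φ : F) :
    ‖R φ‖ + ‖φ + z • R φ‖ ≤ (1 + (1 + ‖z‖) * |z.im|⁻¹) * ‖φ‖ := by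
  calc ‖R φ‖ + ‖φ + z • R φ‖ ≤ ‖R φ‖ + (‖φ‖ + ‖z‖ * ‖R φ‖) := by
        rw [← norm_smul]
        gcongr
        exact norm_add_le _ _
    _ = ‖φ‖ + (1 + ‖z‖) * ‖R φ‖ := by ring
    _ ≤ ‖φ‖ + (1 + ‖z‖) * (|z.im|⁻¹ * ‖φ‖) := by
        gcongr
        exact hR.norm_apply_le hA hz φ
    _ = (1 + (1 + ‖z‖) * |z.im|⁻¹) * ‖φ‖ := by ring

theorem norm_resolvent_sub_le {V Rᵥ : F →L[ℂ] F} {ε C : ℝ} (hε : 0 ≤ ε) (hA : IsSelfAdjoint A)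
    (hV : IsSelfAdjoint V) (hC : ‖V‖ ≤ C) (hVε : GraphFormBound A V ε) (hz : z.im ≠ 0)
    (hRᵥ : IsResolvent ((V : F →ₗ[ℂ] F) +ᵥ A) z Rᵥ) (hR : IsResolvent A z R) :
    ‖Rᵥ - R‖ ≤ ε * ((1 + (1 + ‖z‖) * |z.im|⁻¹) * (1 + (1 + ‖z‖ + C) * |z.im|⁻¹)) := by
  have hz' : (starRingEnd ℂ z).im ≠ 0 := by simpa using hz
  have hAV := isSelfAdjoint_vadd hA hV
  obtain ⟨S, hS⟩ := exists_isResolvent hA hz'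
  have hC₀ : 0 ≤ C := (norm_nonneg V).trans hC
  have hleft : ∀ φ : F, ‖φ‖ = 1 →
      ‖S φ‖ + ‖φ + starRingEnd ℂ z • S φ‖ ≤ 1 + (1 + ‖z‖) * |z.im|⁻¹ := fun φ hφ => by
    simpa [hφ] using hS.norm_add_norm_le hA hz' φ
  have hright : ∀ ψ : F, ‖ψ‖ = 1 →
      ‖Rᵥ ψ‖ + ‖ψ + z • Rᵥ ψ - V (Rᵥ ψ)‖ ≤ 1 + (1 + ‖z‖ + C) * |z.im|⁻¹ := fun ψ hψ => by
    have h₁ := hRᵥ.norm_add_norm_le hAV hz ψ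
    have h₂ : ‖V (Rᵥ ψ)‖ ≤ C * |z.im|⁻¹ := V.le_of_opNorm_le_of_le hC
      (by simpa [hψ] using hRᵥ.norm_apply_le hAV hz ψ)
    have h₃ := norm_sub_le (ψ + z • Rᵥ ψ) (V (Rᵥ ψ))
    rw [hψ, mul_one] at h₁
    linarith
  refine ContinuousLinearMap.opNorm_le_of_re_inner_le (by positivity) fun ψ φ hψ hφ => ?_
  calc RCLike.re (inner ℂ ((Rᵥ - R) ψ) φ) ≤ ‖inner ℂ ((Rᵥ - R) ψ) φ‖ := RCLike.re_le_norm _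
    _ = ‖inner ℂ (S φ) (V (Rᵥ ψ))‖ := by
        rw [norm_inner_symm, inner_resolvent_sub hA hRᵥ hR hS, norm_neg]
    _ ≤ ε * ((‖S φ‖ + ‖φ + starRingEnd ℂ z • S φ‖) * (‖Rᵥ ψ‖ + ‖ψ + z • Rᵥ ψ - V (Rᵥ ψ)‖)) :=
        hVε _ _ _ _ (hS.mem_graph φ) (mem_graph_vadd.1 (hRᵥ.mem_graph ψ))
    _ ≤ ε * ((1 + (1 + ‖z‖) * |z.im|⁻¹) * (1 + (1 + ‖z‖ + C) * |z.im|⁻¹)) :=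
        mul_le_mul_of_nonneg_left
          (mul_le_mul (hleft φ hφ) (hright ψ hψ) (by positivity) (by positivity)) hε

theorem normResolventTendsto_of_graphFormBound (hA : IsSelfAdjoint A) {V : ℕ → F →L[ℂ] F}
    (hV : ∀ n, IsSelfAdjoint (V n)) {C : ℝ} (hC : ∀ n, ‖V n‖ ≤ C) {ε : ℕ → ℝ}
    (hε₀ : ∀ n, 0 ≤ ε n) (hε : Tendsto ε atTop (𝓝 0)) (hVε : ∀ n, GraphFormBound A (V n) (ε n)) :
    NormResolventTendsto (fun n => (V n : F →ₗ[ℂ] F) +ᵥ A) A := by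
  refine ⟨fun n => isSelfAdjoint_vadd hA (hV n), hA, fun z hz => ?_⟩
  choose Rᵥ hRᵥ using fun n => exists_isResolvent (isSelfAdjoint_vadd hA (hV n)) hz
  obtain ⟨R, hR⟩ := exists_isResolvent hA hz
  refine ⟨Rᵥ, R, hRᵥ, hR, tendsto_iff_norm_sub_tendsto_zero.2 ?_⟩
  refine squeeze_zero (fun _ => norm_nonneg _) (fun n =>
    norm_resolvent_sub_le (hε₀ n) hA (hV n) (hC n) (hVε n) hz (hRᵥ n) hR) ?_
  simpa using hε.mul_const ((1 + (1 + ‖z‖) * |z.im|⁻¹) * (1 + (1 + ‖z‖ + C) * |z.im|⁻¹))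

end Resolvent

section Exponential

open scoped Nat
open Finset.HasAntidiagonal (antidiagonal mem_antidiagonal)

variable {𝕜 E F : Type*} [RCLike 𝕜]

section DividedPower

variable [AddCommGroup E] [Module 𝕜 E]

/-- The divided power `Aⁿ / n!`, set to `0` for `n < 0`, so that index shifts in the exponential
series need no case distinction. -/
def dividedPower (A : Module.End 𝕜 E) : ℤ → Module.End 𝕜 E
  | Int.ofNat n => (n ! : 𝕜)⁻¹ • A ^ n
  | Int.negSucc _ => 0

theorem dividedPower_natCast (A : Module.End 𝕜 E) (n : ℕ) :
    dividedPower A n = (n ! : 𝕜)⁻¹ • A ^ n := rfl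

theorem dividedPower_of_neg (A : Module.End 𝕜 E) {n : ℤ} (hn : n < 0) :
    dividedPower A n = 0 := by
  obtain ⟨k, rfl⟩ := Int.eq_negSucc_of_lt_zero hn
  rfl

theorem dividedPower_zero (A : Module.End 𝕜 E) : dividedPower A 0 = 1 := by
  simpa using dividedPower_natCast A 0

theorem mul_dividedPower (A : Module.End 𝕜 E) (n : ℤ) :
    A * dividedPower A n = ((n + 1 : ℤ) : 𝕜) • dividedPower A (n + 1) := by
  rcases lt_trichotomy n (-1) with hn | rfl | hn
  · rw [dividedPower_of_neg A (by omega), dividedPower_of_neg A (by omega), mul_zero, smul_zero]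
  · rw [dividedPower_of_neg A (by omega), mul_zero, neg_add_cancel, Int.cast_zero, zero_smul]
  · obtain ⟨k, rfl⟩ := Int.eq_ofNat_of_zero_le (by omega : 0 ≤ n)
    have hk : ((k : 𝕜) + 1) ≠ 0 := by exact_mod_cast k.succ_ne_zero
    rw [← Nat.cast_add_one, dividedPower_natCast, dividedPower_natCast, mul_smul_comm,
      ← pow_succ', smul_smul, Nat.factorial_succ]
    congr 1
    push_cast
    field_simp

theorem dividedPower_neg (A : Module.End 𝕜 E) (n : ℕ) :
    dividedPower (-A) n = (-1 : 𝕜) ^ n • dividedPower A n := by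
  simp only [dividedPower_natCast, ← neg_one_smul 𝕜 A, smul_pow, smul_comm (n ! : 𝕜)⁻¹]

theorem sum_antidiagonal_dividedPower_neg_mul (A : Module.End 𝕜 E) (N : ℕ) :
    ∑ p ∈ antidiagonal N, dividedPower (-A) p.1 * dividedPower A p.2 = if N = 0 then 1 else 0 := by
  have hterm : ∀ p ∈ antidiagonal N, dividedPower (-A) p.1 * dividedPower A p.2 =
      (N ! : 𝕜)⁻¹ • N.choose p.1 • ((-A) ^ p.1 * A ^ p.2) := fun p hp => by
    have hN : N - p.1 = p.2 := by have := mem_antidiagonal.1 hp; omega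
    have hle : p.1 ≤ N := by have := mem_antidiagonal.1 hp; omega
    rw [dividedPower_natCast, dividedPower_natCast, smul_mul_smul_comm, ← Nat.cast_smul_eq_nsmul 𝕜,
      smul_smul, Nat.cast_choose 𝕜 hle, hN]
    have hN₀ : (N ! : 𝕜) ≠ 0 := by exact_mod_cast N.factorial_ne_zero
    congr 1
    field_simp
  rw [Finset.sum_congr rfl hterm, ← Finset.smul_sum, ← (Commute.refl A).neg_left.add_pow',
    neg_add_cancel]
  rcases N with _ | N <;> simp

variable {A Φ : Module.End 𝕜 E} {c : 𝕜}

theorem dividedPower_commutator (hΦ : ∀ x, Φ (A x) = A (Φ x) + c • x) (n : ℕ) (x : E) :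
    Φ (dividedPower A n x) = dividedPower A n (Φ x) + c • dividedPower A (n - 1) x := by
  induction n with
  | zero => simp [dividedPower_zero, dividedPower_of_neg]
  | succ n ih =>
    have hrec : ∀ (k : ℤ) (y : E),
        A (dividedPower A k y) = ((k + 1 : ℤ) : 𝕜) • dividedPower A (k + 1) y :=
      fun k y => LinearMap.congr_fun (mul_dividedPower A k) y
    have hn : ((n + 1 : ℤ) : 𝕜) ≠ 0 := by exact_mod_cast n.succ_ne_zero
    have key := hΦ (dividedPower A n x)
    rw [hrec, map_smul, ih, map_add, map_smul, hrec, hrec, sub_add_cancel] at key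
    push_cast
    rw [add_sub_cancel_right, ← sub_eq_zero, ← smul_eq_zero_iff_right hn, ← sub_eq_zero.2 key]
    push_cast
    module

/-- If `[L, A] = Φ` and `[Φ, A] = c` on the graph `G` of `L`, then
`L Aⁿ/n! = Aⁿ/n! L + Aⁿ⁻¹/(n-1)! Φ + (c/2) Aⁿ⁻²/(n-2)!`. -/
theorem dividedPower_mem_of_commutator (hΦ : ∀ x, Φ (A x) = A (Φ x) + c • x)
    {G : Submodule 𝕜 (E × E)} (hG : ∀ x u, (x, u) ∈ G → (A x, A u + Φ x) ∈ G) {x u : E}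
    (hxu : (x, u) ∈ G) (n : ℕ) :
    (dividedPower A n x, dividedPower A n u + dividedPower A (n - 1) (Φ x)
      + (c / 2) • dividedPower A (n - 2) x) ∈ G := by
  induction n with
  | zero => simpa [dividedPower_zero, dividedPower_of_neg] using hxu
  | succ n ih =>
    have hrec : ∀ (k : ℤ) (y : E),
        A (dividedPower A k y) = ((k + 1 : ℤ) : 𝕜) • dividedPower A (k + 1) y :=
      fun k y => LinearMap.congr_fun (mul_dividedPower A k) y
    have hn : ((n + 1 : ℤ) : 𝕜) ≠ 0 := by exact_mod_cast n.succ_ne_zero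
    have key := hG _ _ ih
    rw [dividedPower_commutator hΦ, map_add, map_add, map_smul, hrec, hrec, hrec, hrec] at key
    rw [← Submodule.smul_mem_iff G hn]
    convert key using 1
    rw [show (n : ℤ) - 2 + 1 = n - 1 by ring, show (n : ℤ) - 1 + 1 = n by ring,
      show ((n + 1 : ℕ) : ℤ) - 2 = n - 1 by push_cast; ring,
      show ((n + 1 : ℕ) : ℤ) - 1 = n by push_cast; ring, Nat.cast_add_one, Prod.smul_mk]
    congr 1
    push_cast
    module

end DividedPower

theorem summable_norm_dividedPower_of_le [NormedAddCommGroup E] [NormedSpace 𝕜 E]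
    {A : Module.End 𝕜 E} {x : E} {C : ℝ}
    (h : ∀ n : ℕ, ‖A (dividedPower A n x)‖ ≤ C * Real.sqrt (n + 1) * ‖dividedPower A n x‖) :
    Summable fun n : ℕ => ‖dividedPower A n x‖ := by
  refine summable_of_ratio_norm_eventually_le (r := 1 / 2) (by norm_num) ?_
  have hsqrt : Tendsto (fun n : ℕ => Real.sqrt (n + 1)) atTop atTop :=
    Real.tendsto_sqrt_atTop.comp (tendsto_atTop_add_const_right _ _ tendsto_natCast_atTop_atTop)
  filter_upwards [hsqrt.eventually_ge_atTop (2 * C)] with n hn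
  have hstep : ((n : ℝ) + 1) * ‖dividedPower A (n + 1 : ℕ) x‖ ≤
      C * Real.sqrt (n + 1) * ‖dividedPower A n x‖ := by
    convert h n using 1
    rw [← Module.End.mul_apply, mul_dividedPower, LinearMap.smul_apply, norm_smul]
    congr 1
    rw [show (((n : ℤ) + 1 : ℤ) : 𝕜) = ((n + 1 : ℕ) : 𝕜) by push_cast; rfl, RCLike.norm_natCast]
    push_cast
    rfl
  have hpos : 0 < Real.sqrt ((n : ℝ) + 1) := Real.sqrt_pos.2 (by positivity)
  rw [norm_norm, norm_norm]
  refine le_of_mul_le_mul_left ?_ (mul_pos hpos hpos)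
  calc _ = ((n : ℝ) + 1) * ‖dividedPower A (n + 1 : ℕ) x‖ := by
        rw [Real.mul_self_sqrt (by positivity)]
    _ ≤ C * (Real.sqrt (n + 1) * ‖dividedPower A n x‖) := hstep.trans_eq (mul_assoc _ _ _)
    _ ≤ Real.sqrt (n + 1) / 2 * (Real.sqrt (n + 1) * ‖dividedPower A n x‖) := by
        gcongr
        linarith
    _ = _ := by ring

variable [NormedAddCommGroup F] [InnerProductSpace 𝕜 F]

/-- Skew-symmetry of an operator with an invariant domain. -/
def IsSkew {E : Type*} [NormedAddCommGroup E] [InnerProductSpace 𝕜 E] (A : Module.End 𝕜 E) : Prop :=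
  ∀ x y, inner 𝕜 (A x) y = -inner 𝕜 x (A y)

section Skew

variable [NormedAddCommGroup E] [InnerProductSpace 𝕜 E] {A : Module.End 𝕜 E}

theorem IsSkew.neg (hA : IsSkew A) : IsSkew (-A) := fun x y => by simp [hA x y]

theorem IsSkew.inner_pow (hA : IsSkew A) (n : ℕ) (x y : E) :
    inner 𝕜 ((A ^ n) x) y = inner 𝕜 x (((-A) ^ n) y) := by
  induction n generalizing x with
  | zero => simp
  | succ n ih =>
    rw [pow_succ, Module.End.mul_apply, ih, pow_succ', Module.End.mul_apply, LinearMap.neg_apply,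
      inner_neg_right, hA]

theorem IsSkew.inner_dividedPower (hA : IsSkew A) (n : ℕ) (x y : E) :
    inner 𝕜 (dividedPower A n x) y = inner 𝕜 x (dividedPower (-A) n y) := by
  simp only [dividedPower_natCast, LinearMap.smul_apply, inner_smul_left, inner_smul_right,
    hA.inner_pow, map_inv₀, map_natCast]

theorem IsSkew.sum_antidiagonal_inner (hA : IsSkew A) (x y : E) (N : ℕ) :
    ∑ p ∈ antidiagonal N, inner 𝕜 (dividedPower A p.1 x) (dividedPower A p.2 y) =
      if N = 0 then inner 𝕜 x y else 0 := by
  simp only [hA.inner_dividedPower, ← Module.End.mul_apply, ← inner_sum, ← LinearMap.sum_apply,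
    sum_antidiagonal_dividedPower_neg_mul]
  split_ifs <;> simp

end Skew

variable {D₀ : Submodule 𝕜 F} {A : Module.End 𝕜 D₀} {x y : D₀} {a b : F}

theorem IsSkew.inner_hasSum (hA : IsSkew A) (hx : Summable fun n : ℕ => ‖dividedPower A n x‖)
    (hy : Summable fun n : ℕ => ‖dividedPower A n y‖)
    (ha : HasSum (fun n : ℕ => (dividedPower A n x : F)) a)
    (hb : HasSum (fun n : ℕ => (dividedPower A n y : F)) b) : inner 𝕜 a b = inner 𝕜 x y := by
  have hsummable : Summable fun p : ℕ × ℕ =>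
      inner 𝕜 (dividedPower A p.1 x : F) (dividedPower A p.2 y : F) :=
    Summable.of_norm_bounded (hx.mul_of_nonneg hy (fun _ => norm_nonneg _) fun _ => norm_nonneg _)
      fun p => norm_inner_le_norm _ _
  have hinner : ∀ n : ℕ, HasSum
      (fun m : ℕ => inner 𝕜 (dividedPower A n x : F) (dividedPower A m y : F))
      (inner 𝕜 (dividedPower A n x : F) b) :=
    fun n => (innerSL 𝕜 (dividedPower A n x : F)).hasSum hb
  have houter : HasSum (fun n : ℕ => inner 𝕜 (dividedPower A n x : F) b) (inner 𝕜 a b) :=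
    (innerSLFlip 𝕜 b).hasSum ha
  have hdiag : ∀ N : ℕ, ∑' p : antidiagonal N,
      inner 𝕜 (dividedPower A p.1.1 x : F) (dividedPower A p.1.2 y : F) =
        if N = 0 then inner 𝕜 (x : F) (y : F) else 0 := fun N => by
    rw [tsum_fintype]
    exact (Finset.sum_coe_sort (antidiagonal N) fun p =>
      inner 𝕜 (dividedPower A p.1 x : F) (dividedPower A p.2 y : F)).trans
        (hA.sum_antidiagonal_inner x y N)
  rw [← (hsummable.hasSum.prod_fiberwise hinner).unique houter,
    ← Finset.HasAntidiagonal.sigmaAntidiagonalEquivProd.tsum_eq]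
  exact (Summable.tsum_sigma' (fun N => (hasSum_fintype _).summable)
    (Finset.HasAntidiagonal.sigmaAntidiagonalEquivProd.summable_iff.2 hsummable)).trans
      ((tsum_congr hdiag).trans (tsum_ite_eq _ _))

theorem hasSum_dividedPower_sub (h : HasSum (fun n : ℕ => (dividedPower A n x : F)) a) (k : ℕ) :
    HasSum (fun n : ℕ => (dividedPower A (n - k) x : F)) a := by
  have hzero : ∑ n ∈ Finset.range k, (dividedPower A ((n : ℤ) - k) x : F) = 0 :=
    Finset.sum_eq_zero fun n hn => by
      rw [dividedPower_of_neg A (by have := Finset.mem_range.1 hn; omega)]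
      rfl
  rw [← hasSum_nat_add_iff' k, hzero, sub_zero]
  simpa using h

/-- The integrated form `L e^A = e^A (L + Φ + c / 2)` of `[L, A] = Φ`, `[Φ, A] = c`, for a closed
relation `L` with graph `G`. -/
theorem exp_mem_of_commutator {Φ : Module.End 𝕜 D₀} {c : 𝕜}
    (hΦ : ∀ x, Φ (A x) = A (Φ x) + c • x) {G : Submodule 𝕜 (F × F)}
    (hG_closed : IsClosed (G : Set (F × F)))
    (hG : ∀ x u : D₀, ((x : F), (u : F)) ∈ G → ((A x : F), (A u + Φ x : F)) ∈ G)
    {W : F →L[𝕜] F} (hW : ∀ x : D₀, HasSum (fun n : ℕ => (dividedPower A n x : F)) (W x))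
    {x u : D₀} (hxu : ((x : F), (u : F)) ∈ G) :
    (W x, W (u + Φ x + (c / 2) • x)) ∈ G := by
  let G₀ : Submodule 𝕜 (D₀ × D₀) := G.comap (D₀.subtype.prodMap D₀.subtype)
  have hterm := dividedPower_mem_of_commutator hΦ (G := G₀) hG hxu
  have hsum := (hW x).prodMk (((hW u).add (hasSum_dividedPower_sub (hW (Φ x)) 1)).add
    ((hasSum_dividedPower_sub (hW x) 2).const_smul (c / 2)))
  rw [map_add, map_add, map_smul]
  exact hG_closed.mem_of_tendsto hsum (Eventually.of_forall fun s => G.sum_mem fun n _ => hterm n)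

variable [CompleteSpace F]

theorem IsSkew.exists_isometry_hasSum (hA : IsSkew A) (hD : Dense (D₀ : Set F))
    (hs : ∀ x, Summable fun n : ℕ => ‖dividedPower A n x‖) :
    ∃ W : F →ₗᵢ[𝕜] F, ∀ x : D₀, HasSum (fun n : ℕ => (dividedPower A n x : F)) (W x) := by
  have hsum : ∀ x, HasSum (fun n : ℕ => (dividedPower A n x : F))
      (∑' n : ℕ, (dividedPower A n x : F)) :=
    fun x => (Summable.of_norm (f := fun n : ℕ => (dividedPower A n x : F)) (hs x)).hasSum
  let W₀ : D₀ →ₗ[𝕜] F :=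
    { toFun := fun x => ∑' n : ℕ, (dividedPower A n x : F)
      map_add' := fun x y => by
        simpa only [map_add, Submodule.coe_add] using ((hsum x).add (hsum y)).tsum_eq
      map_smul' := fun c x => by
        simpa only [map_smul, Submodule.coe_smul, RingHom.id_apply] using
          ((hsum x).const_smul c).tsum_eq }
  have hnorm₀ : ∀ x : D₀, ‖W₀ x‖ = ‖(x : F)‖ := fun x => by
    have := hA.inner_hasSum (hs x) (hs x) (hsum x) (hsum x)
    rw [inner_self_eq_norm_sq_to_K, inner_self_eq_norm_sq_to_K] at this
    exact (sq_eq_sq₀ (norm_nonneg _) (norm_nonneg _)).1 (by exact_mod_cast this)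
  have hdense : DenseRange D₀.subtype := hD.denseRange_val
  have hext : ∀ x : D₀, W₀.extendOfNorm D₀.subtype x = W₀ x :=
    LinearMap.extendOfNorm_eq hdense ⟨1, fun x => by simp [hnorm₀]⟩
  have hnorm : ∀ x : F, ‖W₀.extendOfNorm D₀.subtype x‖ = ‖x‖ :=
    hdense.induction (by rintro _ ⟨x, rfl⟩; exact (congrArg norm (hext x)).trans (hnorm₀ x))
      (isClosed_eq (by fun_prop) continuous_norm)
  refine ⟨⟨(W₀.extendOfNorm D₀.subtype).toLinearMap, hnorm⟩, fun x => ?_⟩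
  exact (hext x).symm ▸ hsum x

theorem IsSkew.exists_unitary_hasSum (hA : IsSkew A) (hD : Dense (D₀ : Set F))
    (hs : ∀ x, Summable fun n : ℕ => ‖dividedPower A n x‖) :
    ∃ W : F ≃ₗᵢ[𝕜] F, (∀ x : D₀, HasSum (fun n : ℕ => (dividedPower A n x : F)) (W x)) ∧
      ∀ x : D₀, HasSum (fun n : ℕ => (dividedPower (-A) n x : F)) (W.symm x) := by
  obtain ⟨W, hW⟩ := hA.exists_isometry_hasSum hD hs
  obtain ⟨W', hW'⟩ := hA.neg.exists_isometry_hasSum hD fun x => by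
    simpa [dividedPower_neg, norm_smul] using hs x
  have hadj₀ : ∀ x y : D₀, inner 𝕜 (W x) (y : F) = inner 𝕜 (x : F) (W' y) := fun x y =>
    ((innerSLFlip 𝕜 (y : F)).hasSum (hW x)).unique <|
      ((innerSL 𝕜 (x : F)).hasSum (hW' y)).congr_fun fun n => hA.inner_dividedPower n x y
  have hadj : ∀ x y, inner 𝕜 (W x) y = inner 𝕜 x (W' y) := fun x y =>
    hD.induction (P := fun x => inner 𝕜 (W x) y = inner 𝕜 x (W' y))
      (fun x hx => hD.induction (P := fun y => inner 𝕜 (W x) y = inner 𝕜 x (W' y))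
        (fun y hy => hadj₀ ⟨x, hx⟩ ⟨y, hy⟩)
        (isClosed_eq (by fun_prop) (by have := W'.continuous; fun_prop)) y)
      (isClosed_eq (by have := W.continuous; fun_prop) (by fun_prop)) x
  have hleft : ∀ x, W' (W x) = x := fun x => ext_inner_left 𝕜 fun y => by
    rw [← hadj, W.inner_map_map]
  have hright : ∀ x, W (W' x) = x := fun x => ext_inner_right 𝕜 fun y => by
    rw [hadj, W'.inner_map_map]
  exact ⟨⟨LinearEquiv.ofLinearMap W.toLinearMap W'.toLinearMap (LinearMap.ext hright)
    (LinearMap.ext hleft), W.norm_map⟩, hW, hW'⟩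

end Exponential

section Sectors

variable {X : Type*} [MeasurableSpace X] {μ : Measure X} [SigmaFinite μ] {n : ℕ}

section Contraction

variable (X) in
/-- The change of variables `((k₁, …, kₙ), x) ↦ (x, k₁, …, kₙ)`. -/
def consEquiv (n : ℕ) : (Fin n → X) × X ≃ᵐ (Fin (n + 1) → X) :=
  MeasurableEquiv.prodComm.trans (MeasurableEquiv.piFinSuccAbove (fun _ : Fin (n + 1) => X) 0).symm

theorem consEquiv_zero (p : (Fin n → X) × X) : consEquiv X n p 0 = p.2 := rfl

theorem consEquiv_succ (p : (Fin n → X) × X) (i : Fin n) : consEquiv X n p i.succ = p.1 i := rfl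

theorem consEquiv_zero_succAbove (p : (Fin n → X) × X) :
    (fun i => consEquiv X n p ((0 : Fin (n + 1)).succAbove i)) = p.1 := rfl

theorem consEquiv_succ_succAbove (k : Fin (n + 1) → X) (x : X) (j : Fin (n + 1)) :
    (fun i => consEquiv X (n + 1) (k, x) (j.succ.succAbove i)) =
      consEquiv X n (fun i => k (j.succAbove i), x) := by
  funext i
  refine Fin.cases ?_ (fun i => ?_) i
  · rw [Fin.succ_succAbove_zero]; rfl
  · rw [Fin.succ_succAbove_succ]; rfl

theorem measurePreserving_consEquiv (n : ℕ) :
    MeasurePreserving (consEquiv X n) ((Measure.pi (fun _ : Fin n => μ)).prod μ)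
      (Measure.pi (fun _ : Fin (n + 1) => μ)) :=
  ((measurePreserving_piFinSuccAbove (fun _ : Fin (n + 1) => μ) 0).symm _).comp
    Measure.measurePreserving_swap

theorem ae_ae_consEquiv {p : (Fin (n + 1) → X) → Prop}
    (h : ∀ᵐ K ∂Measure.pi (fun _ : Fin (n + 1) => μ), p K) :
    ∀ᵐ k ∂Measure.pi (fun _ : Fin n => μ), ∀ᵐ x ∂μ, p (consEquiv X n (k, x)) :=
  Measure.ae_ae_of_ae_prod ((measurePreserving_consEquiv n).quasiMeasurePreserving.ae h)

/-- The contraction of the first variable with `g`, i.e. the adjoint of tensoring with `g`. -/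
def contract (g : Lp ℂ 2 μ) (n : ℕ) : NBody μ (n + 1) →L[ℂ] NBody μ n :=
  ContinuousLinearMap.adjoint (insertAt g n 0)

theorem inner_insertAt_zero_ae_eq (g : Lp ℂ 2 μ) (χ : NBody μ n) (Φ : NBody μ (n + 1)) :
    (fun p => inner ℂ (insertAt g n 0 χ (consEquiv X n p)) (Φ (consEquiv X n p)))
      =ᵐ[(Measure.pi (fun _ : Fin n => μ)).prod μ]
        fun p => starRingEnd ℂ (χ p.1) * (starRingEnd ℂ (g p.2) * Φ (consEquiv X n p)) := by
  filter_upwards [(measurePreserving_consEquiv n).quasiMeasurePreserving.ae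
    (coeFn_insertAt g n 0 χ)] with p hp
  rw [hp, consEquiv_zero_succAbove, consEquiv_zero, RCLike.inner_apply, map_mul]
  ring

theorem integrable_conj_mul_conj_mul (g : Lp ℂ 2 μ) (χ : NBody μ n) (Φ : NBody μ (n + 1)) :
    Integrable (fun p => starRingEnd ℂ (χ p.1) * (starRingEnd ℂ (g p.2) * Φ (consEquiv X n p)))
      ((Measure.pi (fun _ : Fin n => μ)).prod μ) :=
  (((measurePreserving_consEquiv n).integrable_comp_emb (consEquiv X n).measurableEmbedding).2
    (L2.integrable_inner (𝕜 := ℂ) (insertAt g n 0 χ) Φ)).congr (inner_insertAt_zero_ae_eq g χ Φ)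

theorem inner_insertAt_zero (g : Lp ℂ 2 μ) (χ : NBody μ n) (Φ : NBody μ (n + 1)) :
    inner ℂ (insertAt g n 0 χ) Φ = ∫ k, starRingEnd ℂ (χ k) *
      ∫ x, starRingEnd ℂ (g x) * Φ (consEquiv X n (k, x)) ∂μ ∂Measure.pi (fun _ : Fin n => μ) := by
  simp only [L2.inner_def, ← (measurePreserving_consEquiv n).integral_comp',
    integral_congr_ae (inner_insertAt_zero_ae_eq g χ Φ),
    integral_prod _ (integrable_conj_mul_conj_mul g χ Φ), integral_const_mul]

theorem coeFn_contract (g : Lp ℂ 2 μ) (n : ℕ) (Φ : NBody μ (n + 1)) :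
    contract g n Φ =ᵐ[Measure.pi (fun _ : Fin n => μ)]
      fun k => ∫ x, starRingEnd ℂ (g x) * Φ (consEquiv X n (k, x)) ∂μ := by
  set P : (Fin n → X) → ℂ :=
    fun k => ∫ x, starRingEnd ℂ (g x) * Φ (consEquiv X n (k, x)) ∂μ with hP
  have hindicator : ∀ {s : Set (Fin n → X)} (hs : MeasurableSet s)
      (hμs : Measure.pi (fun _ : Fin n => μ) s ≠ ∞),
      (fun k => starRingEnd ℂ (indicatorConstLp 2 hs hμs (1 : ℂ) k) * P k)
        =ᵐ[Measure.pi (fun _ : Fin n => μ)] s.indicator P := fun {s} hs hμs => by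
    filter_upwards [indicatorConstLp_coeFn (p := 2) (hs := hs) (hμs := hμs) (c := (1 : ℂ))]
      with k hk
    by_cases hks : k ∈ s <;> simp [hk, hks]
  refine ae_eq_of_forall_setIntegral_eq_of_sigmaFinite
    (fun s _ hμs => integrableOn_Lp_of_measure_ne_top _ one_le_two hμs.ne)
    (fun s hs hμs => ?_) fun s hs hμs => ?_
  · have hint :=
      (integrable_conj_mul_conj_mul g (indicatorConstLp 2 hs hμs.ne 1) Φ).integral_prod_left
    simp only [integral_const_mul] at hint
    exact (integrable_indicator_iff hs).1 (hint.congr (hindicator hs hμs.ne))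
  · rw [← L2.inner_indicatorConstLp_one (𝕜 := ℂ) hs hμs.ne, contract,
      ContinuousLinearMap.adjoint_inner_right, inner_insertAt_zero, ← hP,
      integral_congr_ae (hindicator hs hμs.ne), integral_indicator hs]

theorem contract_insertAt_zero (g f : Lp ℂ 2 μ) (ψ : NBody μ n) :
    contract g n (insertAt f n 0 ψ) = (inner ℂ g f : ℂ) • ψ := by
  apply Lp.ext
  filter_upwards [coeFn_contract g n (insertAt f n 0 ψ), Lp.coeFn_smul (inner ℂ g f : ℂ) ψ,
    ae_ae_consEquiv (coeFn_insertAt f n 0 ψ)] with k hcontract hsmul hinsert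
  rw [hcontract, hsmul, Pi.smul_apply, L2.inner_def, smul_eq_mul, ← integral_mul_const]
  refine integral_congr_ae ?_
  filter_upwards [hinsert] with x hx
  rw [hx, consEquiv_zero, consEquiv_zero_succAbove, RCLike.inner_apply]
  ring

theorem contract_insertAt_succ (g f : Lp ℂ 2 μ) (j : Fin (n + 1)) (ψ : NBody μ (n + 1)) :
    contract g (n + 1) (insertAt f (n + 1) j.succ ψ) = insertAt f n j (contract g n ψ) := by
  apply Lp.ext
  filter_upwards [coeFn_contract g (n + 1) (insertAt f (n + 1) j.succ ψ),
    coeFn_insertAt f n j (contract g n ψ),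
    (quasiMeasurePreserving_succAbove (μ := μ) n j).ae (coeFn_contract g n ψ),
    ae_ae_consEquiv (coeFn_insertAt f (n + 1) j.succ ψ)]
    with k hcontract hinsert hcontract' hinsert'
  rw [hcontract, hinsert, hcontract', ← integral_const_mul]
  refine integral_congr_ae ?_
  filter_upwards [hinsert'] with x hx
  rw [hx, consEquiv_succ, consEquiv_succ_succAbove]
  ring

theorem contract_mem_symSpace (g : Lp ℂ 2 μ) (Φ : symSpace μ (n + 1)) :
    contract g n Φ ∈ symSpace μ n := by
  intro σ
  have hcontract := coeFn_contract g n (Φ : NBody μ (n + 1))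
  filter_upwards [hcontract, (measurePreserving_perm μ n σ).quasiMeasurePreserving.ae hcontract,
    ae_ae_consEquiv (Φ.2 (Equiv.Perm.decomposeFin.symm (0, σ)))] with k hk hkσ hsymm
  rw [hk, hkσ]
  refine integral_congr_ae ?_
  filter_upwards [hsymm] with x hx
  rw [← hx]
  congr 2
  funext i
  refine Fin.cases ?_ (fun i => ?_) i
  · rw [Equiv.Perm.decomposeFin_symm_apply_zero]; rfl
  · rw [Equiv.Perm.decomposeFin_symm_apply_succ, Equiv.swap_self]; rfl

end Contraction

section CanonicalCommutation

theorem insertAt_eq_compMeasurePreserving (f : Lp ℂ 2 μ) (j : Fin (n + 1)) (χ : NBody μ n) :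
    insertAt f n j χ = Lp.compMeasurePreservingₗᵢ ℂ _
      (measurePreserving_perm μ (n + 1) j.cycleRange.symm) (insertAt f n 0 χ) := by
  have hperm := measurePreserving_perm μ (n + 1) j.cycleRange.symm
  apply Lp.ext
  filter_upwards [coeFn_insertAt f n j χ,
    hperm.quasiMeasurePreserving.ae (coeFn_insertAt f n 0 χ),
    Lp.coeFn_compMeasurePreserving (insertAt f n 0 χ) hperm] with k hk hk₀ hcomp
  refine hk.trans (Eq.trans ?_ hcomp.symm)
  rw [Function.comp_apply, hk₀, Fin.cycleRange_symm_zero]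
  congr 2
  funext i
  rw [Fin.succAbove_zero, Fin.cycleRange_symm_succ]

theorem compMeasurePreserving_symSpace (Φ : symSpace μ n) (σ : Equiv.Perm (Fin n)) :
    Lp.compMeasurePreservingₗᵢ ℂ _ (measurePreserving_perm μ n σ) (Φ : NBody μ n) = Φ :=
  Lp.ext ((Lp.coeFn_compMeasurePreserving (Φ : NBody μ n) (measurePreserving_perm μ n σ)).trans
    (Φ.2 σ))

theorem inner_insertAt_symSpace (f : Lp ℂ 2 μ) (j : Fin (n + 1)) (χ : NBody μ n)
    (Φ : symSpace μ (n + 1)) :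
    inner ℂ (insertAt f n j χ) (Φ : NBody μ (n + 1)) =
      inner ℂ (insertAt f n 0 χ) (Φ : NBody μ (n + 1)) := by
  rw [insertAt_eq_compMeasurePreserving, ← compMeasurePreserving_symSpace Φ j.cycleRange.symm,
    LinearIsometry.inner_map_map, compMeasurePreserving_symSpace]

theorem sqrt_succ_mul_self (n : ℕ) :
    (Real.sqrt (n + 1) : ℂ) * (Real.sqrt (n + 1) : ℂ) = n + 1 := by
  exact_mod_cast congrArg Complex.ofReal (Real.mul_self_sqrt (by positivity : (0 : ℝ) ≤ n + 1))

theorem sqrt_succ_ne_zero (n : ℕ) : (Real.sqrt (n + 1) : ℂ) ≠ 0 :=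
  Complex.ofReal_ne_zero.2 (Real.sqrt_pos.2 (by positivity)).ne'

theorem sqrt_smul_createAux (f : Lp ℂ 2 μ) (χ : NBody μ n) :
    (Real.sqrt (n + 1) : ℂ) • createAux f n χ = ∑ j : Fin (n + 1), insertAt f n j χ := by
  simp [createAux, smul_smul, mul_inv_cancel₀ (sqrt_succ_ne_zero n)]

theorem inner_createAux_symSpace (f : Lp ℂ 2 μ) (χ : NBody μ n) (Φ : symSpace μ (n + 1)) :
    inner ℂ (createAux f n χ) (Φ : NBody μ (n + 1)) =
      Real.sqrt (n + 1) * inner ℂ (insertAt f n 0 χ) (Φ : NBody μ (n + 1)) := by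
  apply mul_left_cancel₀ (sqrt_succ_ne_zero n)
  calc (Real.sqrt (n + 1) : ℂ) * inner ℂ (createAux f n χ) (Φ : NBody μ (n + 1))
      = inner ℂ (∑ j : Fin (n + 1), insertAt f n j χ) (Φ : NBody μ (n + 1)) := by
        rw [← sqrt_smul_createAux, inner_smul_left, Complex.conj_ofReal]
    _ = (n + 1) * inner ℂ (insertAt f n 0 χ) (Φ : NBody μ (n + 1)) := by
        simp [sum_inner, inner_insertAt_symSpace f _ χ Φ]
    _ = _ := by rw [← mul_assoc, sqrt_succ_mul_self]

theorem coe_createSector (f : Lp ℂ 2 μ) (ψ : symSpace μ n) :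
    (createSector f n ψ : NBody μ (n + 1)) = createAux f n ψ := rfl

theorem coe_annihilateSector (f : Lp ℂ 2 μ) (Φ : symSpace μ (n + 1)) :
    (annihilateSector f n Φ : NBody μ n) = (Real.sqrt (n + 1) : ℂ) • contract f n Φ := by
  suffices annihilateSector f n Φ =
      (Real.sqrt (n + 1) : ℂ) • (⟨contract f n Φ, contract_mem_symSpace f Φ⟩ : symSpace μ n) from
    congrArg Subtype.val this
  refine ext_inner_left ℂ fun χ => ?_
  rw [annihilateSector, ContinuousLinearMap.adjoint_inner_right, Submodule.coe_inner,
    Submodule.coe_inner, coe_createSector, inner_createAux_symSpace, Submodule.coe_smul,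
    inner_smul_right]
  exact congrArg _ (ContinuousLinearMap.adjoint_inner_right _ _ _).symm

theorem coe_annihilateSector_createSector (g f : Lp ℂ 2 μ) (ψ : symSpace μ n) :
    (annihilateSector g n (createSector f n ψ) : NBody μ n) =
      (inner ℂ g f : ℂ) • (ψ : NBody μ n) +
        ∑ j : Fin n, contract g n (insertAt f n j.succ ψ) := by
  rw [coe_annihilateSector, coe_createSector, ← map_smul, sqrt_smul_createAux, Fin.sum_univ_succ,
    map_add, map_sum, contract_insertAt_zero]

theorem annihilateSector_createSector_zero (g f : Lp ℂ 2 μ) (ψ : symSpace μ 0) :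
    annihilateSector g 0 (createSector f 0 ψ) = (inner ℂ g f : ℂ) • ψ :=
  Subtype.ext ((coe_annihilateSector_createSector g f ψ).trans (add_zero _))

theorem annihilateSector_createSector_succ (g f : Lp ℂ 2 μ) (ψ : symSpace μ (n + 1)) :
    annihilateSector g (n + 1) (createSector f (n + 1) ψ) =
      createSector f n (annihilateSector g n ψ) + (inner ℂ g f : ℂ) • ψ := by
  apply Subtype.ext
  rw [coe_annihilateSector_createSector, Submodule.coe_add, coe_createSector,
    coe_annihilateSector, map_smul, sqrt_smul_createAux]
  simp only [contract_insertAt_succ, Submodule.coe_smul]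
  exact add_comm _ _

theorem insertAt_smul (c : ℂ) (f : Lp ℂ 2 μ) (j : Fin (n + 1)) (ψ : NBody μ n) :
    insertAt (c • f) n j ψ = c • insertAt f n j ψ := by
  apply Lp.ext
  filter_upwards [(Measure.quasiMeasurePreserving_eval (fun _ : Fin (n + 1) => μ) j).ae
      (Lp.coeFn_smul c f), coeFn_insertAt (c • f) n j ψ, coeFn_insertAt f n j ψ,
    Lp.coeFn_smul c (insertAt f n j ψ)] with k hf hinsert hinsert' hsmul
  rw [Function.eval] at hf
  rw [hinsert, hsmul, Pi.smul_apply, hinsert', hf, Pi.smul_apply, smul_mul_assoc]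

theorem createSector_smul (c : ℂ) (f : Lp ℂ 2 μ) (n : ℕ) :
    createSector (c • f) n = c • createSector f n := by
  ext1 ψ
  apply Subtype.ext
  change createAux (c • f) n ψ = c • createAux f n ψ
  simp only [createAux, smul_apply, sum_apply, insertAt_smul]
  rw [← Finset.smul_sum, smul_comm]

theorem annihilateSector_smul (c : ℂ) (f : Lp ℂ 2 μ) (n : ℕ) :
    annihilateSector (c • f) n = starRingEnd ℂ c • annihilateSector f n := by
  rw [annihilateSector, createSector_smul, map_smulₛₗ]
  rfl

end CanonicalCommutation

section SecondQuantization

variable {ω : X → ℝ} {m : ℝ}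

/-- `φ` is `dΓ(ω) ψ` in the `n`-boson space: the `n`-th component of `dGammaGraph`. -/
def IsSectorDGamma (ω : X → ℝ) (ψ φ : symSpace μ n) : Prop :=
  ((φ : NBody μ n) : (Fin n → X) → ℂ) =ᵐ[Measure.pi (fun _ : Fin n => μ)]
    fun k => ((∑ j, ω (k j) : ℝ) : ℂ) * (ψ : NBody μ n) k

theorem IsSectorDGamma.inner_eq {a b x y : symSpace μ n} (hab : IsSectorDGamma ω a b)
    (hxy : IsSectorDGamma ω x y) : inner ℂ b x = inner ℂ a y := by
  rw [Submodule.coe_inner, Submodule.coe_inner, L2.inner_def, L2.inner_def]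
  refine integral_congr_ae ?_
  filter_upwards [hab, hxy] with k hb hy
  rw [hb, hy, RCLike.inner_apply, RCLike.inner_apply, map_mul, Complex.conj_ofReal]
  ring

theorem ae_mul_le_sum (hωm : ∀ᵐ k ∂μ, m ≤ ω k) (n : ℕ) :
    ∀ᵐ k ∂Measure.pi (fun _ : Fin n => μ), m * n ≤ ∑ j, ω (k j) := by
  filter_upwards [ae_all_iff.2 fun j : Fin n =>
    (Measure.quasiMeasurePreserving_eval (fun _ : Fin n => μ) j).ae hωm] with k hk
  calc m * n = ∑ _j : Fin n, m := by simp [mul_comm]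
    _ ≤ _ := Finset.sum_le_sum fun j _ => hk j

theorem IsSectorDGamma.mul_norm_le (hm : 0 ≤ m) (hωm : ∀ᵐ k ∂μ, m ≤ ω k) {ψ φ : symSpace μ n}
    (h : IsSectorDGamma ω ψ φ) : m * n * ‖ψ‖ ≤ ‖φ‖ := by
  have hnorm : ‖((m * n : ℝ) : ℂ)‖ = m * n := by
    rw [Complex.norm_real, Real.norm_of_nonneg (by positivity)]
  suffices ‖((m * n : ℝ) : ℂ) • (ψ : NBody μ n)‖ ≤ ‖(φ : NBody μ n)‖ by
    rwa [norm_smul, hnorm] at this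
  refine Lp.norm_le_norm_of_ae_le ?_
  filter_upwards [h, ae_mul_le_sum hωm n, Lp.coeFn_smul ((m * n : ℝ) : ℂ) (ψ : NBody μ n)]
    with k hφ hle hsmul
  rw [hφ, hsmul, Pi.smul_apply, norm_smul, norm_mul, hnorm, Complex.norm_real]
  gcongr
  exact hle.trans (le_abs_self _)

theorem exists_symSpace_coeFn_eq_mul {u : (Fin n → X) → ℂ} (hu : Measurable u)
    (hsymm : ∀ (σ : Equiv.Perm (Fin n)) k, u (fun i => k (σ i)) = u k) {C : ℝ}
    (hC : ∀ᵐ k ∂Measure.pi (fun _ : Fin n => μ), ‖u k‖ ≤ C) (η : symSpace μ n) :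
    ∃ χ : symSpace μ n, ‖χ‖ ≤ C * ‖η‖ ∧ (χ : NBody μ n) =ᵐ[Measure.pi (fun _ : Fin n => μ)]
      fun k => u k * (η : NBody μ n) k := by
  have hle : ∀ᵐ k ∂Measure.pi (fun _ : Fin n => μ),
      ‖u k * (η : NBody μ n) k‖ ≤ C * ‖(η : NBody μ n) k‖ := by
    filter_upwards [hC] with k hk
    rw [norm_mul]
    gcongr
  have hL : MemLp (fun k => u k * (η : NBody μ n) k) 2 (Measure.pi (fun _ : Fin n => μ)) :=
    (Lp.memLp (η : NBody μ n)).of_le_mul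
      (hu.aestronglyMeasurable.mul (Lp.aestronglyMeasurable (η : NBody μ n))) hle
  have hmem : hL.toLp _ ∈ symSpace μ n := fun σ => by
    filter_upwards [hL.coeFn_toLp,
      (measurePreserving_perm μ n σ).quasiMeasurePreserving.ae hL.coeFn_toLp, η.2 σ]
      with k hk hkσ hη
    rw [hk, hkσ, hη, hsymm]
  have hnorm : ‖hL.toLp _‖ ≤ C * ‖(η : NBody μ n)‖ := by
    refine Lp.norm_le_mul_norm_of_ae_le_mul ?_
    filter_upwards [hle, hL.coeFn_toLp] with k hk hk'
    rwa [hk']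
  exact ⟨⟨hL.toLp _, hmem⟩, hnorm, hL.coeFn_toLp⟩

theorem exists_isSectorDGamma_sub (hω : Measurable ω) (hω₀ : ∀ᵐ k ∂μ, 0 ≤ ω k)
    (η : symSpace μ n) : ∃ χ : symSpace μ n, ‖χ‖ ≤ ‖η‖ ∧ IsSectorDGamma ω χ (η - χ) := by
  have hpos := ae_mul_le_sum hω₀ n
  simp only [zero_mul] at hpos
  have hle : ∀ᵐ k ∂Measure.pi (fun _ : Fin n => μ), ‖((1 + ∑ j, ω (k j) : ℝ) : ℂ)⁻¹‖ ≤ 1 := by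
    filter_upwards [hpos] with k hk
    rw [norm_inv, Complex.norm_real, Real.norm_of_nonneg (by linarith)]
    exact inv_le_one_of_one_le₀ (by linarith)
  have hsymm : ∀ (σ : Equiv.Perm (Fin n)) (k : Fin n → X),
      ((1 + ∑ j, ω (k (σ j)) : ℝ) : ℂ)⁻¹ = ((1 + ∑ j, ω (k j) : ℝ) : ℂ)⁻¹ := fun σ k => by
    rw [Equiv.sum_comp σ fun j => ω (k j)]
  obtain ⟨χ, hχ, hχη⟩ := exists_symSpace_coeFn_eq_mul (by fun_prop) hsymm hle η
  refine ⟨χ, by rwa [one_mul] at hχ, ?_⟩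
  filter_upwards [hpos, hχη, Lp.coeFn_sub (η : NBody μ n) (χ : NBody μ n)] with k hk hχk hsub
  have hne : ((1 + ∑ j, ω (k j) : ℝ) : ℂ) ≠ 0 := Complex.ofReal_ne_zero.2 (by linarith)
  rw [Submodule.coe_sub, hsub, Pi.sub_apply, hχk,
    show ((∑ j, ω (k j) : ℝ) : ℂ) = ((1 + ∑ j, ω (k j) : ℝ) : ℂ) - 1 by push_cast; ring]
  field_simp

theorem IsSectorDGamma.createSector {f g : Lp ℂ 2 μ} (hfg : f =ᵐ[μ] fun k => (ω k : ℂ) * g k)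
    {ψ φ : symSpace μ n} (h : IsSectorDGamma ω ψ φ) :
    IsSectorDGamma ω (createSector g n ψ) (createSector g n φ + createSector f n ψ) := by
  have hφ := ae_all_iff.2 fun j : Fin (n + 1) =>
    (quasiMeasurePreserving_succAbove (μ := μ) n j).ae h
  have hf := ae_all_iff.2 fun j : Fin (n + 1) =>
    (Measure.quasiMeasurePreserving_eval (fun _ : Fin (n + 1) => μ) j).ae hfg
  simp only [Function.eval] at hf
  filter_upwards [Lp.coeFn_add (createAux g n (φ : NBody μ n)) (createAux f n (ψ : NBody μ n)),
    coeFn_createAux g n (φ : NBody μ n), coeFn_createAux f n (ψ : NBody μ n),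
    coeFn_createAux g n (ψ : NBody μ n), hφ, hf] with k hadd hgφ hfψ hgψ hφk hfk
  rw [Submodule.coe_add, coe_createSector, coe_createSector, coe_createSector, hadd, Pi.add_apply,
    hgφ, hfψ, hgψ, ← mul_add, ← Finset.sum_add_distrib, mul_left_comm]
  congr 1
  rw [Finset.mul_sum]
  refine Finset.sum_congr rfl fun j _ => ?_
  rw [hφk j, hfk j, Fin.sum_univ_succAbove (fun i => ω (k i)) j]
  push_cast
  ring

end SecondQuantization

end Sectors

section FockOperators

variable {X : Type*} [MeasurableSpace X] {μ : Measure X} [SigmaFinite μ]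

section NumberNorm

theorem hasSum_norm_sq (x : Fock μ) : HasSum (fun n => ‖x n‖ ^ 2) (‖x‖ ^ 2) := by
  simpa using lp.hasSum_norm (p := 2) (by norm_num) x

theorem hasSum_norm_sq_succ (x : Fock μ) :
    HasSum (fun n => ‖x (n + 1)‖ ^ 2) (‖x‖ ^ 2 - ‖x 0‖ ^ 2) := by
  simpa using (hasSum_nat_add_iff' (f := fun n => ‖x n‖ ^ 2) 1).2 (hasSum_norm_sq x)

/-- The norm `‖(𝒩 + 1)^{1/2} x‖`, where `𝒩` is the number operator; it is meaningful on
`domSqrtNumber μ`. -/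
def numberNorm (x : Fock μ) : ℝ := Real.sqrt (∑' n : ℕ, ((n : ℝ) + 1) * ‖x n‖ ^ 2)

theorem hasSum_numberNorm_sq (x : domSqrtNumber μ) :
    HasSum (fun n : ℕ => ((n : ℝ) + 1) * ‖(x : Fock μ) n‖ ^ 2) (numberNorm (x : Fock μ) ^ 2) := by
  have hx : Summable fun n : ℕ => (n : ℝ) * ‖(x : Fock μ) n‖ ^ 2 := x.2
  rw [numberNorm, Real.sq_sqrt (tsum_nonneg fun n => by positivity)]
  refine Summable.hasSum ?_
  simpa only [add_mul, one_mul] using hx.add (hasSum_norm_sq (x : Fock μ)).summable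

theorem numberNorm_nonneg (x : Fock μ) : 0 ≤ numberNorm x := Real.sqrt_nonneg _

theorem numberNorm_le {x : domSqrtNumber μ} {c C : ℝ} (hC : 0 ≤ C) {u : ℕ → ℝ}
    (hu : HasSum u c) (hcC : c ≤ C ^ 2)
    (h : ∀ n : ℕ, ((n : ℝ) + 1) * ‖(x : Fock μ) n‖ ^ 2 ≤ u n) : numberNorm (x : Fock μ) ≤ C :=
  le_of_sq_le_sq ((hasSum_le h (hasSum_numberNorm_sq x) hu).trans hcC) hC

theorem norm_create_le (f : Lp ℂ 2 μ) (x : domSqrtNumber μ) :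
    ‖create f x‖ ≤ ‖f‖ * numberNorm (x : Fock μ) := by
  refine le_of_sq_le_sq ?_ (mul_nonneg (norm_nonneg _) (numberNorm_nonneg _))
  have hzero : (create f x) 0 = 0 := rfl
  have hsum := hasSum_norm_sq_succ (create f x)
  rw [hzero, norm_zero, zero_pow two_ne_zero, sub_zero] at hsum
  rw [mul_pow]
  exact hasSum_le (fun n => sq_le_of_le_sqrt (by positivity) (norm_nonneg _)
    ((createSector f n).le_of_opNorm_le (norm_createSector_le f n) _)) hsum
    ((hasSum_numberNorm_sq x).mul_left _)

theorem norm_annihilate_le (f : Lp ℂ 2 μ) (x : domSqrtNumber μ) :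
    ‖annihilate f x‖ ≤ ‖f‖ * numberNorm (x : Fock μ) := by
  refine le_of_sq_le_sq ?_ (mul_nonneg (norm_nonneg _) (numberNorm_nonneg _))
  have hsucc := (hasSum_nat_add_iff' 1).2 (hasSum_numberNorm_sq x)
  rw [mul_pow]
  refine (hasSum_le (fun n => ?_) (hasSum_norm_sq (annihilate f x))
    (hsucc.mul_left (‖f‖ ^ 2))).trans ?_
  · refine (sq_le_of_le_sqrt (by positivity) (norm_nonneg _)
      ((annihilateSector f n).le_of_opNorm_le (norm_annihilateSector_le f n) _)).trans ?_
    gcongr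
    simp
  · gcongr
    simp

theorem inner_create (f : Lp ℂ 2 μ) (x y : domSqrtNumber μ) :
    inner ℂ (create f x) (y : Fock μ) = inner ℂ (x : Fock μ) (annihilate f y) := by
  have hzero : (create f x) 0 = 0 := rfl
  have hcreate := (hasSum_nat_add_iff' 1).2 (lp.hasSum_inner (𝕜 := ℂ) (create f x) (y : Fock μ))
  rw [Finset.sum_range_one, hzero, inner_zero_left, sub_zero] at hcreate
  exact hcreate.unique ((lp.hasSum_inner (𝕜 := ℂ) (x : Fock μ) (annihilate f y)).congr_fun
    fun n => (ContinuousLinearMap.adjoint_inner_right _ _ _).symm)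

theorem create_smul (c : ℂ) (f : Lp ℂ 2 μ) : create (c • f) = c • create f := by
  refine LinearPMap.ext rfl fun x _ _ => lp.ext (funext fun n => ?_)
  cases n with
  | zero => exact (smul_zero (A := symSpace μ 0) c).symm
  | succ n => exact congrArg (· (x n)) (createSector_smul c f n)

theorem annihilate_smul (c : ℂ) (f : Lp ℂ 2 μ) :
    annihilate (c • f) = starRingEnd ℂ c • annihilate f :=
  LinearPMap.ext rfl fun x _ _ => lp.ext <| funext fun n =>
    congrArg (· (x (n + 1))) (annihilateSector_smul c f n)

end NumberNorm

section SecondQuantizationGraph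

variable {ω : X → ℝ} {m : ℝ} {x y : Fock μ}

theorem mem_graph_dGamma : (x, y) ∈ (dGamma μ ω).graph ↔ ∀ n, IsSectorDGamma ω (x n) (y n) := by
  rw [dGamma_graph]
  exact Iff.rfl

theorem isSelfAdjoint_dGamma (hω : Measurable ω) (hω₀ : ∀ᵐ k ∂μ, 0 ≤ ω k) :
    IsSelfAdjoint (dGamma μ ω) := by
  refine isSelfAdjoint_iff_adjoint_graph_eq.2
    (adjoint_eq_self_of_surjective (fun ⟨x, y⟩ hxy => ?_) 1 fun η => ?_)
  · refine mem_adjoint_iff_inner_eq.2 fun a b hab => ?_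
    rw [lp.inner_eq_tsum, lp.inner_eq_tsum]
    exact tsum_congr fun n => (mem_graph_dGamma.1 hab n).inner_eq (mem_graph_dGamma.1 hxy n)
  · choose χ hnorm hχ using fun n => exists_isSectorDGamma_sub hω hω₀ (η n)
    have hmem : Memℓp χ 2 := (memℓp_two_iff _).2 <|
      (hasSum_norm_sq η).summable.of_nonneg_of_le (fun n => by positivity) fun n =>
        pow_le_pow_left₀ (norm_nonneg _) (hnorm n) 2
    refine ⟨⟨χ, hmem⟩, mem_graph_dGamma.2 fun n => ?_⟩
    rw [RCLike.ofReal_one, one_smul]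
    exact hχ n

theorem succ_mul_norm_sq_le (hm : 0 < m) (hωm : ∀ᵐ k ∂μ, m ≤ ω k)
    (h : (x, y) ∈ (dGamma μ ω).graph) (n : ℕ) :
    ((n : ℝ) + 1) * ‖x n‖ ^ 2 ≤ ‖x n‖ ^ 2 + m⁻¹ ^ 2 * ‖y n‖ ^ 2 := by
  have hle : n * ‖x n‖ ≤ m⁻¹ * ‖y n‖ := by
    rw [inv_mul_eq_div, le_div_iff₀' hm, ← mul_assoc]
    exact (mem_graph_dGamma.1 h n).mul_norm_le hm.le hωm
  have hn : (n : ℝ) ≤ (n : ℝ) ^ 2 := by exact_mod_cast Nat.le_self_pow two_ne_zero n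
  calc ((n : ℝ) + 1) * ‖x n‖ ^ 2 = ‖x n‖ ^ 2 + n * ‖x n‖ ^ 2 := by ring
    _ ≤ ‖x n‖ ^ 2 + (n * ‖x n‖) ^ 2 := by rw [mul_pow]; gcongr
    _ ≤ ‖x n‖ ^ 2 + (m⁻¹ * ‖y n‖) ^ 2 := by gcongr
    _ = _ := by rw [mul_pow]

theorem hasSum_norm_sq_add (x y : Fock μ) (c : ℝ) :
    HasSum (fun n => ‖x n‖ ^ 2 + c * ‖y n‖ ^ 2) (‖x‖ ^ 2 + c * ‖y‖ ^ 2) :=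
  (hasSum_norm_sq x).add ((hasSum_norm_sq y).mul_left c)

theorem mem_domSqrtNumber_of_mem_graph (hm : 0 < m) (hωm : ∀ᵐ k ∂μ, m ≤ ω k)
    (h : (x, y) ∈ (dGamma μ ω).graph) : x ∈ domSqrtNumber μ :=
  (hasSum_norm_sq_add x y (m⁻¹ ^ 2)).summable.of_nonneg_of_le (fun n => by positivity) fun n =>
    le_trans (by gcongr; linarith) (succ_mul_norm_sq_le hm hωm h n)

theorem numberNorm_le_of_mem_graph (hm : 0 < m) (hωm : ∀ᵐ k ∂μ, m ≤ ω k)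
    (h : (x, y) ∈ (dGamma μ ω).graph) : numberNorm x ≤ ‖x‖ + m⁻¹ * ‖y‖ := by
  refine numberNorm_le (x := ⟨x, mem_domSqrtNumber_of_mem_graph hm hωm h⟩) (by positivity)
    (hasSum_norm_sq_add x y (m⁻¹ ^ 2)) ?_ (succ_mul_norm_sq_le hm hωm h)
  have : 0 ≤ ‖x‖ * (m⁻¹ * ‖y‖) := by positivity
  linarith [add_sq ‖x‖ (m⁻¹ * ‖y‖), mul_pow m⁻¹ ‖y‖ 2]

end SecondQuantizationGraph

section FiniteParticles

variable (μ) in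
/-- The vectors with fewer than `p` particles. -/
def particlesLT (p : ℕ) : Submodule ℂ (Fock μ) where
  carrier := {x | ∀ n, p ≤ n → x n = 0}
  zero_mem' := fun _ _ => rfl
  add_mem' := fun {a b} ha hb n hn => by
    rw [lp.coeFn_add, Pi.add_apply, ha n hn, hb n hn, add_zero]
  smul_mem' := fun c a ha n hn => by
    rw [lp.coeFn_smul, Pi.smul_apply, ha n hn, smul_zero]

variable (μ) in
/-- The vectors with finitely many particles. -/
def finiteVec : Submodule ℂ (Fock μ) := ⨆ p, particlesLT μ p

theorem particlesLT_mono : Monotone (particlesLT μ) := fun _ _ hpq _ hx n hn =>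
  hx n (hpq.trans hn)

theorem particlesLT_le_finiteVec (p : ℕ) : particlesLT μ p ≤ finiteVec μ := le_iSup _ p

theorem mem_finiteVec {x : Fock μ} : x ∈ finiteVec μ ↔ ∃ p, x ∈ particlesLT μ p :=
  Submodule.mem_iSup_of_directed _ particlesLT_mono.directed_le

theorem finiteVec_le_domSqrtNumber : finiteVec μ ≤ domSqrtNumber μ := fun x hx => by
  obtain ⟨p, hp⟩ := mem_finiteVec.1 hx
  refine summable_of_ne_finset_zero (s := Finset.range p) fun n hn => ?_
  rw [hp n (by simpa using hn), norm_zero, zero_pow two_ne_zero, mul_zero]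

theorem numberNorm_le_of_mem_particlesLT {p : ℕ} {x : Fock μ} (hx : x ∈ particlesLT μ p) :
    numberNorm x ≤ Real.sqrt p * ‖x‖ := by
  refine numberNorm_le
    (x := ⟨x, finiteVec_le_domSqrtNumber (particlesLT_le_finiteVec p hx)⟩) (by positivity)
    ((hasSum_norm_sq x).mul_left (p : ℝ)) ?_ fun n => ?_
  · rw [mul_pow, Real.sq_sqrt (by positivity)]
  · rcases lt_or_ge n p with hn | hn
    · gcongr
      exact_mod_cast hn
    · simp [hx n hn]

/-- The projection to fewer than `p` particles. -/
def trunc (p : ℕ) (x : Fock μ) : Fock μ := ∑ n ∈ Finset.range p, lp.single 2 n (x n)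

theorem trunc_apply (p : ℕ) (x : Fock μ) (n : ℕ) : trunc p x n = if n < p then x n else 0 := by
  simp only [trunc, lp.coeFn_sum, Finset.sum_apply, lp.coeFn_single, Finset.sum_pi_single,
    Finset.mem_range]

theorem tendsto_trunc (x : Fock μ) : Tendsto (fun p => trunc p x) atTop (𝓝 x) :=
  (lp.hasSum_single (by norm_num) x).tendsto_sum_nat

theorem trunc_mem_finiteVec (p : ℕ) (x : Fock μ) : trunc p x ∈ finiteVec μ :=
  particlesLT_le_finiteVec p fun n hn => by rw [trunc_apply, if_neg hn.not_gt]

theorem dense_finiteVec : Dense (finiteVec μ : Set (Fock μ)) := fun x =>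
  mem_closure_of_tendsto (tendsto_trunc x) (Eventually.of_forall fun p => trunc_mem_finiteVec p x)

/-- The finite particle vectors in the domain form a core of `dΓ(ω)`. -/
theorem dGamma_graph_induction {ω : X → ℝ} {P : (dGamma μ ω).graph → Prop}
    (hP : IsClosed {p | P p})
    (hfin : ∀ (x u : finiteVec μ) (h : ((x : Fock μ), (u : Fock μ)) ∈ (dGamma μ ω).graph),
      P ⟨_, h⟩) (p : (dGamma μ ω).graph) : P p := by
  obtain ⟨⟨x, y⟩, hxy⟩ := p
  have htrunc : ∀ p, (trunc p x, trunc p y) ∈ (dGamma μ ω).graph := fun p =>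
    mem_graph_dGamma.2 fun n => by
      rw [trunc_apply, trunc_apply]
      split_ifs
      · exact mem_graph_dGamma.1 hxy n
      · exact mem_graph_dGamma.1 (dGamma μ ω).graph.zero_mem n
  have hlim : Tendsto (fun p => (⟨_, htrunc p⟩ : (dGamma μ ω).graph)) atTop (𝓝 ⟨(x, y), hxy⟩) :=
    tendsto_subtype_rng.2 ((tendsto_trunc x).prodMk_nhds (tendsto_trunc y))
  exact hP.mem_of_tendsto hlim (Eventually.of_forall fun p =>
    hfin ⟨_, trunc_mem_finiteVec p x⟩ ⟨_, trunc_mem_finiteVec p y⟩ (htrunc p))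

theorem create_mem_particlesLT (f : Lp ℂ 2 μ) {p : ℕ} {x : domSqrtNumber μ}
    (hx : (x : Fock μ) ∈ particlesLT μ p) : create f x ∈ particlesLT μ (p + 1) := fun n hn => by
  obtain ⟨n, rfl⟩ := Nat.exists_eq_add_one.2 (Nat.zero_lt_of_lt hn)
  exact (congrArg (createSector f n) (hx n (Nat.le_of_succ_le_succ hn))).trans (map_zero _)

theorem annihilate_mem_particlesLT (f : Lp ℂ 2 μ) {p : ℕ} {x : domSqrtNumber μ}
    (hx : (x : Fock μ) ∈ particlesLT μ (p + 1)) : annihilate f x ∈ particlesLT μ p :=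
  fun n hn => (congrArg (annihilateSector f n) (hx (n + 1) (by omega))).trans (map_zero _)

/-- The creation operator on the invariant domain of finite particle vectors. -/
def createFin (f : Lp ℂ 2 μ) : Module.End ℂ (finiteVec μ) :=
  ((create f).toFun ∘ₗ Submodule.inclusion finiteVec_le_domSqrtNumber).codRestrict (finiteVec μ)
    fun x => by
      obtain ⟨p, hp⟩ := mem_finiteVec.1 x.2
      exact particlesLT_le_finiteVec _
        (create_mem_particlesLT f (x := ⟨x, finiteVec_le_domSqrtNumber x.2⟩) hp)

/-- The annihilation operator on the invariant domain of finite particle vectors. -/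
def annihilateFin (f : Lp ℂ 2 μ) : Module.End ℂ (finiteVec μ) :=
  ((annihilate f).toFun ∘ₗ Submodule.inclusion finiteVec_le_domSqrtNumber).codRestrict
    (finiteVec μ) fun x => by
      obtain ⟨p, hp⟩ := mem_finiteVec.1 x.2
      exact particlesLT_le_finiteVec p (annihilate_mem_particlesLT f
        (x := ⟨x, finiteVec_le_domSqrtNumber x.2⟩) (particlesLT_mono p.le_succ hp))

theorem inner_createFin (f : Lp ℂ 2 μ) (x y : finiteVec μ) :
    inner ℂ (createFin f x : Fock μ) (y : Fock μ) = inner ℂ (x : Fock μ) (annihilateFin f y) :=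
  inner_create f ⟨x, finiteVec_le_domSqrtNumber x.2⟩ ⟨y, finiteVec_le_domSqrtNumber y.2⟩

theorem inner_annihilateFin (f : Lp ℂ 2 μ) (x y : finiteVec μ) :
    inner ℂ (annihilateFin f x : Fock μ) (y : Fock μ) = inner ℂ (x : Fock μ) (createFin f y) := by
  rw [← inner_conj_symm, ← inner_createFin, inner_conj_symm]

theorem annihilateFin_createFin (g f : Lp ℂ 2 μ) (x : finiteVec μ) :
    annihilateFin g (createFin f x) = createFin f (annihilateFin g x) + (inner ℂ g f : ℂ) • x := by
  apply Subtype.ext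
  apply lp.ext
  funext n
  cases n with
  | zero =>
    exact (annihilateSector_createSector_zero g f ((x : Fock μ) 0)).trans (zero_add _).symm
  | succ n => exact annihilateSector_createSector_succ g f ((x : Fock μ) (n + 1))

/-- The commutator of two creation operators commutes with all annihilation operators, so it
vanishes on a vector as soon as it does on all `a(h) x`. -/
theorem createFin_comm_of_annihilateFin (f g : Lp ℂ 2 μ) {x : finiteVec μ}
    (hx : ∀ h, createFin f (createFin g (annihilateFin h x)) =
      createFin g (createFin f (annihilateFin h x))) :
    createFin f (createFin g x) = createFin g (createFin f x) := by
  have hann : ∀ h,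
      annihilateFin h (createFin f (createFin g x) - createFin g (createFin f x)) = 0 := fun h => by
    simp only [map_sub, annihilateFin_createFin, map_add, map_smul, hx h]
    abel
  rw [← sub_eq_zero, ← Submodule.coe_eq_zero, ← inner_self_eq_zero (𝕜 := ℂ)]
  nth_rewrite 1 [Submodule.coe_sub]
  simp only [inner_sub_left, inner_createFin, hann, Submodule.coe_zero, inner_zero_right, sub_zero]

theorem createFin_comm (f g : Lp ℂ 2 μ) (x : finiteVec μ) :
    createFin f (createFin g x) = createFin g (createFin f x) := by
  obtain ⟨p, hp⟩ := mem_finiteVec.1 x.2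
  induction p generalizing x with
  | zero =>
    obtain rfl : x = 0 := Subtype.ext (lp.ext (funext fun n => hp n n.zero_le))
    simp only [map_zero]
  | succ p ih =>
    exact createFin_comm_of_annihilateFin f g fun h => ih _ <|
      annihilate_mem_particlesLT h (x := ⟨x, finiteVec_le_domSqrtNumber x.2⟩) hp

theorem annihilateFin_comm (f g : Lp ℂ 2 μ) (x : finiteVec μ) :
    annihilateFin f (annihilateFin g x) = annihilateFin g (annihilateFin f x) :=
  Subtype.ext <| dense_finiteVec.eq_of_inner_left ℂ fun y hy => by
    lift y to finiteVec μ using hy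
    simp only [inner_annihilateFin, createFin_comm f g]

theorem createFin_mem_graph {ω : X → ℝ} {f g : Lp ℂ 2 μ}
    (hfg : f =ᵐ[μ] fun k => (ω k : ℂ) * g k) {x u : finiteVec μ}
    (h : ((x : Fock μ), (u : Fock μ)) ∈ (dGamma μ ω).graph) :
    ((createFin g x : Fock μ), (createFin g u + createFin f x : Fock μ)) ∈
      (dGamma μ ω).graph := by
  refine mem_graph_dGamma.2 fun n => ?_
  cases n with
  | zero =>
    have hsum : (createFin g u + createFin f x : Fock μ) 0 = 0 := add_zero (0 : symSpace μ 0)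
    rw [hsum]
    exact mem_graph_dGamma.1 (dGamma μ ω).graph.zero_mem 0
  | succ n => exact (mem_graph_dGamma.1 h n).createSector hfg

theorem annihilateFin_mem_graph {ω : X → ℝ} (hω : Measurable ω) (hω₀ : ∀ᵐ k ∂μ, 0 ≤ ω k)
    {f g : Lp ℂ 2 μ} (hfg : f =ᵐ[μ] fun k => (ω k : ℂ) * g k) {x u : finiteVec μ}
    (h : ((x : Fock μ), (u : Fock μ)) ∈ (dGamma μ ω).graph) :
    ((annihilateFin g x : Fock μ), (annihilateFin g u - annihilateFin f x : Fock μ)) ∈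
      (dGamma μ ω).graph := by
  have hsa := isSelfAdjoint_dGamma hω hω₀
  rw [← isSelfAdjoint_iff_adjoint_graph_eq.1 hsa, mem_adjoint_iff_inner_eq]
  intro a b hab
  refine dGamma_graph_induction (P := fun p => inner ℂ (p : Fock μ × Fock μ).2 (annihilateFin g x) =
    inner ℂ (p : Fock μ × Fock μ).1 (annihilateFin g u - annihilateFin f x : Fock μ))
    (isClosed_eq (by fun_prop) (by fun_prop)) (fun a b hab => ?_) ⟨(a, b), hab⟩
  have hcreate := inner_eq_inner_of_mem_graph hsa (createFin_mem_graph hfg hab) h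
  rw [inner_add_left] at hcreate
  simp only [inner_createFin, inner_sub_right] at hcreate ⊢
  exact eq_sub_of_add_eq hcreate

end FiniteParticles

end FockOperators

section Weyl

variable {X : Type*} [MeasurableSpace X] {μ : Measure X} {ω : X → ℝ} {m : ℝ}

theorem ae_nonneg_of_ae_le (hm : 0 < m) (hωm : ∀ᵐ k ∂μ, m ≤ ω k) : ∀ᵐ k ∂μ, 0 ≤ ω k :=
  hωm.mono fun _ hk => hm.le.trans hk

theorem smul_ae_eq_mul_smul {f g : Lp ℂ 2 μ} (hfg : f =ᵐ[μ] fun k => (ω k : ℂ) * g k) (c : ℂ) :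
    (c • f : Lp ℂ 2 μ) =ᵐ[μ] fun k => (ω k : ℂ) * (c • g : Lp ℂ 2 μ) k := by
  filter_upwards [hfg, Lp.coeFn_smul c f, Lp.coeFn_smul c g] with k hk hcf hcg
  rw [hcf, hcg, Pi.smul_apply, Pi.smul_apply, hk, smul_eq_mul, smul_eq_mul, mul_left_comm]

variable [SigmaFinite μ]

section Generator

/-- The generator `a*(g) - a(g)` of the Weyl operators, on finite particle vectors. -/
def weylGen (g : Lp ℂ 2 μ) : Module.End ℂ (finiteVec μ) := createFin g - annihilateFin g

/-- The field operator `a*(f) + a(f)`, on finite particle vectors. -/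
def fieldFin (f : Lp ℂ 2 μ) : Module.End ℂ (finiteVec μ) := createFin f + annihilateFin f

theorem isSkew_weylGen (g : Lp ℂ 2 μ) :
    IsSkew (𝕜 := ℂ) (E := finiteVec μ) (weylGen g) := fun x y => by
  change inner ℂ (createFin g x - annihilateFin g x : Fock μ) (y : Fock μ) =
    -inner ℂ (x : Fock μ) (createFin g y - annihilateFin g y : Fock μ)
  rw [inner_sub_left, inner_sub_right, inner_createFin, inner_annihilateFin, neg_sub]

theorem fieldFin_weylGen (f g : Lp ℂ 2 μ) (x : finiteVec μ) :
    fieldFin f (weylGen g x) = weylGen g (fieldFin f x) + (inner ℂ f g + inner ℂ g f : ℂ) • x := by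
  simp only [fieldFin, weylGen, LinearMap.add_apply, LinearMap.sub_apply, map_add, map_sub]
  rw [annihilateFin_createFin f g, annihilateFin_createFin g f, createFin_comm f g,
    annihilateFin_comm f g]
  module

theorem annihilateFin_weylGen (h g : Lp ℂ 2 μ) (x : finiteVec μ) :
    annihilateFin h (weylGen g x) = weylGen g (annihilateFin h x) + (inner ℂ h g : ℂ) • x := by
  simp only [weylGen, LinearMap.sub_apply, map_sub]
  rw [annihilateFin_createFin h g, annihilateFin_comm h g]
  module

theorem weylGen_mem_graph (hω : Measurable ω) (hω₀ : ∀ᵐ k ∂μ, 0 ≤ ω k)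
    {f g : Lp ℂ 2 μ} (hfg : f =ᵐ[μ] fun k => (ω k : ℂ) * g k) {x u : finiteVec μ}
    (h : ((x : Fock μ), (u : Fock μ)) ∈ (dGamma μ ω).graph) :
    ((weylGen g x : Fock μ), (weylGen g u + fieldFin f x : Fock μ)) ∈ (dGamma μ ω).graph := by
  convert (dGamma μ ω).graph.sub_mem (createFin_mem_graph hfg h)
    (annihilateFin_mem_graph hω hω₀ hfg h) using 1
  refine Prod.ext rfl ?_
  change (createFin g u - annihilateFin g u : Fock μ) + (createFin f x + annihilateFin f x) =
    (createFin g u + createFin f x) - (annihilateFin g u - annihilateFin f x)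
  abel

variable {p : ℕ} {x : finiteVec μ}

theorem weylGen_mem_particlesLT (g : Lp ℂ 2 μ) (hx : (x : Fock μ) ∈ particlesLT μ p) :
    (weylGen g x : Fock μ) ∈ particlesLT μ (p + 1) :=
  Submodule.sub_mem _ (create_mem_particlesLT g (x := ⟨x, finiteVec_le_domSqrtNumber x.2⟩) hx)
    (particlesLT_mono p.le_succ (annihilate_mem_particlesLT g
      (x := ⟨x, finiteVec_le_domSqrtNumber x.2⟩) (particlesLT_mono p.le_succ hx)))

theorem dividedPower_weylGen_mem_particlesLT (g : Lp ℂ 2 μ) (hx : (x : Fock μ) ∈ particlesLT μ p)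
    (n : ℕ) : (dividedPower (weylGen g) n x : Fock μ) ∈ particlesLT μ (p + n) := by
  refine Submodule.smul_mem _ _ ?_
  induction n with
  | zero => exact hx
  | succ n ih =>
    rw [pow_succ']
    exact weylGen_mem_particlesLT g ih

theorem norm_weylGen_le (g : Lp ℂ 2 μ) (hx : (x : Fock μ) ∈ particlesLT μ p) :
    ‖weylGen g x‖ ≤ 2 * ‖g‖ * Real.sqrt p * ‖x‖ := by
  have hnumber : ‖g‖ * numberNorm (x : Fock μ) ≤ ‖g‖ * (Real.sqrt p * ‖(x : Fock μ)‖) := by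
    gcongr
    exact numberNorm_le_of_mem_particlesLT hx
  calc ‖weylGen g x‖ ≤ ‖createFin g x‖ + ‖annihilateFin g x‖ := norm_sub_le _ _
    _ ≤ ‖g‖ * (Real.sqrt p * ‖x‖) + ‖g‖ * (Real.sqrt p * ‖x‖) :=
      add_le_add ((norm_create_le g _).trans hnumber) ((norm_annihilate_le g _).trans hnumber)
    _ = _ := by ring

theorem summable_norm_dividedPower_weylGen (g : Lp ℂ 2 μ) (x : finiteVec μ) :
    Summable fun n : ℕ => ‖dividedPower (weylGen g) n x‖ := by
  obtain ⟨p, hp⟩ := mem_finiteVec.1 x.2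
  refine summable_norm_dividedPower_of_le (C := 2 * ‖g‖ * Real.sqrt (p + 1)) fun n => ?_
  have hsqrt : Real.sqrt (p + n : ℕ) ≤ Real.sqrt (p + 1) * Real.sqrt (n + 1) := by
    rw [← Real.sqrt_mul (by positivity)]
    refine Real.sqrt_le_sqrt ?_
    push_cast
    nlinarith [mul_nonneg (Nat.cast_nonneg (α := ℝ) p) (Nat.cast_nonneg (α := ℝ) n)]
  calc _ ≤ 2 * ‖g‖ * Real.sqrt (p + n : ℕ) * ‖dividedPower (weylGen g) n x‖ :=
        norm_weylGen_le g (dividedPower_weylGen_mem_particlesLT g hp n)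
    _ ≤ 2 * ‖g‖ * (Real.sqrt (p + 1) * Real.sqrt (n + 1)) * ‖dividedPower (weylGen g) n x‖ := by
        gcongr
    _ = _ := by ring

end Generator

section Unitary

theorem exists_weyl (g : Lp ℂ 2 μ) : ∃ W : Fock μ ≃ₗᵢ[ℂ] Fock μ,
    (∀ x : finiteVec μ, HasSum (fun n : ℕ => (dividedPower (weylGen g) n x : Fock μ)) (W x)) ∧
      ∀ x : finiteVec μ,
        HasSum (fun n : ℕ => (dividedPower (-weylGen g) n x : Fock μ)) (W.symm x) :=
  (isSkew_weylGen g).exists_unitary_hasSum dense_finiteVec (summable_norm_dividedPower_weylGen g)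

/-- The Weyl operator `e^{a*(g) - a(g)}`, given by the exponential series on finite particle
vectors. -/
def weyl (g : Lp ℂ 2 μ) : Fock μ ≃ₗᵢ[ℂ] Fock μ := (exists_weyl g).choose

theorem hasSum_weyl (g : Lp ℂ 2 μ) (x : finiteVec μ) :
    HasSum (fun n : ℕ => (dividedPower (weylGen g) n x : Fock μ)) (weyl g x) :=
  (exists_weyl g).choose_spec.1 x

theorem hasSum_weyl_symm (g : Lp ℂ 2 μ) (x : finiteVec μ) :
    HasSum (fun n : ℕ => (dividedPower (-weylGen g) n x : Fock μ)) ((weyl g).symm x) :=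
  (exists_weyl g).choose_spec.2 x

end Unitary

section Graph

variable (hm : 0 < m) (hωm : ∀ᵐ k ∂μ, m ≤ ω k)

/-- The embedding of the graph of `dΓ(ω)` into the form domain of the number operator. -/
def graphToDom : (dGamma μ ω).graph →ₗ[ℂ] domSqrtNumber μ :=
  (LinearMap.fst ℂ (Fock μ) (Fock μ) ∘ₗ (dGamma μ ω).graph.subtype).codRestrict _
    fun p => mem_domSqrtNumber_of_mem_graph hm hωm p.2

theorem numberNorm_graphToDom_le (p : (dGamma μ ω).graph) :
    numberNorm (graphToDom hm hωm p : Fock μ) ≤ (1 + m⁻¹) * ‖p‖ := by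
  refine (numberNorm_le_of_mem_graph hm hωm p.2).trans ?_
  rw [add_mul, one_mul]
  gcongr
  exacts [norm_fst_le _, norm_snd_le _]

/-- The creation operator, as a bounded operator on the domain of `dΓ(ω)` with its graph norm. -/
def createOnGraph (f : Lp ℂ 2 μ) : (dGamma μ ω).graph →L[ℂ] Fock μ :=
  ((create f).toFun ∘ₗ graphToDom hm hωm).mkContinuous (‖f‖ * (1 + m⁻¹)) fun p =>
    (norm_create_le f _).trans <| by
      rw [mul_assoc]
      gcongr
      exact numberNorm_graphToDom_le hm hωm p

/-- The annihilation operator, as a bounded operator on the domain of `dΓ(ω)` with its graph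
norm. -/
def annihilateOnGraph (f : Lp ℂ 2 μ) : (dGamma μ ω).graph →L[ℂ] Fock μ :=
  ((annihilate f).toFun ∘ₗ graphToDom hm hωm).mkContinuous (‖f‖ * (1 + m⁻¹)) fun p =>
    (norm_annihilate_le f _).trans <| by
      rw [mul_assoc]
      gcongr
      exact numberNorm_graphToDom_le hm hωm p

theorem norm_createOnGraph_le (f : Lp ℂ 2 μ) (p : (dGamma μ ω).graph) :
    ‖createOnGraph hm hωm f p‖ ≤ ‖f‖ * (1 + m⁻¹) * ‖p‖ :=
  ContinuousLinearMap.le_of_opNorm_le _ (LinearMap.mkContinuous_norm_le _ (by positivity) _) p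

theorem norm_annihilateOnGraph_le (f : Lp ℂ 2 μ) (p : (dGamma μ ω).graph) :
    ‖annihilateOnGraph hm hωm f p‖ ≤ ‖f‖ * (1 + m⁻¹) * ‖p‖ :=
  ContinuousLinearMap.le_of_opNorm_le _ (LinearMap.mkContinuous_norm_le _ (by positivity) _) p

theorem inner_createOnGraph (f : Lp ℂ 2 μ) (p q : (dGamma μ ω).graph) :
    inner ℂ (createOnGraph hm hωm f p) (q : Fock μ × Fock μ).1 =
      inner ℂ (p : Fock μ × Fock μ).1 (annihilateOnGraph hm hωm f q) :=
  inner_create f (graphToDom hm hωm p) (graphToDom hm hωm q)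

/-- The field operator `a*(f) + a(f)`, as a bounded operator on the domain of `dΓ(ω)` with its
graph norm. -/
def fieldOnGraph (f : Lp ℂ 2 μ) : (dGamma μ ω).graph →L[ℂ] Fock μ :=
  createOnGraph hm hωm f + annihilateOnGraph hm hωm f

variable (hω : Measurable ω) {f g : Lp ℂ 2 μ} (hfg : f =ᵐ[μ] fun k => (ω k : ℂ) * g k)

include hω hfg in
/-- `dΓ(ω) W = W (dΓ(ω) + a*(f) + a(f) + Re ⟨f, g⟩)` for the Weyl operator `W` of `g = f / ω`. -/
theorem weyl_mem_graph (p : (dGamma μ ω).graph) :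
    (weyl g (p : Fock μ × Fock μ).1, weyl g ((p : Fock μ × Fock μ).2 + fieldOnGraph hm hωm f p +
      ((inner ℂ f g + inner ℂ g f) / 2 : ℂ) • (p : Fock μ × Fock μ).1)) ∈ (dGamma μ ω).graph := by
  have hω₀ := ae_nonneg_of_ae_le hm hωm
  have hclosed : IsClosed ((dGamma μ ω).graph : Set (Fock μ × Fock μ)) :=
    (isSelfAdjoint_dGamma hω hω₀).isClosed
  induction p using dGamma_graph_induction with
  | hP => exact hclosed.preimage (by fun_prop)
  | hfin x u h =>
    exact exp_mem_of_commutator (fieldFin_weylGen f g) hclosed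
      (fun x u h => weylGen_mem_graph hω hω₀ hfg h)
      (W := ((weyl g).toContinuousLinearEquiv : Fock μ →L[ℂ] Fock μ)) (hasSum_weyl g) h

include hω hfg in
theorem weyl_symm_mem_graph (p : (dGamma μ ω).graph) :
    ((weyl g).symm (p : Fock μ × Fock μ).1,
      (weyl g).symm ((p : Fock μ × Fock μ).2 - fieldOnGraph hm hωm f p +
        ((inner ℂ f g + inner ℂ g f) / 2 : ℂ) • (p : Fock μ × Fock μ).1)) ∈
      (dGamma μ ω).graph := by
  have hω₀ := ae_nonneg_of_ae_le hm hωm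
  have hclosed : IsClosed ((dGamma μ ω).graph : Set (Fock μ × Fock μ)) :=
    (isSelfAdjoint_dGamma hω hω₀).isClosed
  have hcomm (x : finiteVec μ) : (-fieldFin f) ((-weylGen g) x) =
      (-weylGen g) ((-fieldFin f) x) + (inner ℂ f g + inner ℂ g f : ℂ) • x := by
    simpa only [LinearMap.neg_apply, map_neg, neg_neg] using fieldFin_weylGen f g x
  have hgraph (x u : finiteVec μ) (h : ((x : Fock μ), (u : Fock μ)) ∈ (dGamma μ ω).graph) :
      (((-weylGen g) x : Fock μ), ((-weylGen g) u + (-fieldFin f) x : Fock μ)) ∈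
        (dGamma μ ω).graph := by
    convert (dGamma μ ω).graph.neg_mem (weylGen_mem_graph hω hω₀ hfg h) using 1
    exact Prod.ext rfl (neg_add _ _).symm
  induction p using dGamma_graph_induction with
  | hP => exact hclosed.preimage (by fun_prop)
  | hfin x u h =>
    rw [sub_eq_add_neg]
    exact exp_mem_of_commutator hcomm hclosed hgraph
      (W := ((weyl g).symm.toContinuousLinearEquiv : Fock μ →L[ℂ] Fock μ)) (hasSum_weyl_symm g) h

/-- The relation consisting of the pairs `(x, y)` for which `y` is `a(h) x` in the weak sense,
against finite particle vectors; unlike `annihilate h`, it is closed. -/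
def weakAnnihilate (h : Lp ℂ 2 μ) : Submodule ℂ (Fock μ × Fock μ) where
  carrier := {q | ∀ φ : finiteVec μ,
    inner ℂ (createFin h φ : Fock μ) q.1 = inner ℂ (φ : Fock μ) q.2}
  zero_mem' := fun φ => by simp
  add_mem' := fun {a b} ha hb φ => by
    rw [Prod.fst_add, Prod.snd_add, inner_add_right, inner_add_right, ha φ, hb φ]
  smul_mem' := fun c a ha φ => by
    rw [Prod.smul_fst, Prod.smul_snd, inner_smul_right, inner_smul_right, ha φ]

theorem isClosed_weakAnnihilate (h : Lp ℂ 2 μ) :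
    IsClosed (weakAnnihilate h : Set (Fock μ × Fock μ)) := by
  have hset : (weakAnnihilate h : Set (Fock μ × Fock μ)) =
      ⋂ φ : finiteVec μ, {q | inner ℂ (createFin h φ : Fock μ) q.1 = inner ℂ (φ : Fock μ) q.2} :=
    Set.ofPred_forall _
  rw [hset]
  exact isClosed_iInter fun φ => isClosed_eq (by fun_prop) (by fun_prop)

theorem mem_weakAnnihilate_iff (h : Lp ℂ 2 μ) (q : (dGamma μ ω).graph) {y : Fock μ} :
    ((q : Fock μ × Fock μ).1, y) ∈ weakAnnihilate h ↔ annihilateOnGraph hm hωm h q = y := by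
  have hq (φ : finiteVec μ) : inner ℂ (createFin h φ : Fock μ) (q : Fock μ × Fock μ).1 =
      inner ℂ (φ : Fock μ) (annihilateOnGraph hm hωm h q) :=
    inner_create h ⟨φ, finiteVec_le_domSqrtNumber φ.2⟩ (graphToDom hm hωm q)
  refine ⟨fun hy => dense_finiteVec.eq_of_inner_right ℂ fun φ hφ => ?_, fun hy φ => hy ▸ hq φ⟩
  exact (hq ⟨φ, hφ⟩).symm.trans (hy ⟨φ, hφ⟩)

/-- `a(h) W = W (a(h) + ⟨h, g⟩)` for the Weyl operator `W` of `g`. -/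
theorem annihilateOnGraph_weyl (h g : Lp ℂ 2 μ) (p q : (dGamma μ ω).graph)
    (hq : (q : Fock μ × Fock μ).1 = weyl g (p : Fock μ × Fock μ).1) :
    annihilateOnGraph hm hωm h q = weyl g (annihilateOnGraph hm hωm h p +
      (inner ℂ h g : ℂ) • (p : Fock μ × Fock μ).1) := by
  rw [← mem_weakAnnihilate_iff, hq]
  have hcomm (x u : finiteVec μ) (hxu : ((x : Fock μ), (u : Fock μ)) ∈ weakAnnihilate h) :
      ((weylGen g x : Fock μ), (weylGen g u + ((inner ℂ h g : ℂ) • x : finiteVec μ) : Fock μ)) ∈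
        weakAnnihilate h := fun φ => by
    obtain rfl : annihilateFin h x = u := Subtype.ext <| dense_finiteVec.eq_of_inner_right ℂ
      fun φ hφ => (inner_createFin h ⟨φ, hφ⟩ x).symm.trans (hxu ⟨φ, hφ⟩)
    rw [inner_createFin, annihilateFin_weylGen]
    rfl
  clear hq
  induction p using dGamma_graph_induction with
  | hP => exact (isClosed_weakAnnihilate h).preimage (by fun_prop)
  | hfin x _ _ =>
    have hexp := exp_mem_of_commutator (Φ := (inner ℂ h g : ℂ) • 1) (c := 0) (fun x => by simp)
      (isClosed_weakAnnihilate h) hcomm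
      (W := ((weyl g).toContinuousLinearEquiv : Fock μ →L[ℂ] Fock μ)) (hasSum_weyl g)
      (x := x) (u := annihilateFin h x) (fun φ => inner_createFin h φ x)
    rw [zero_div, zero_smul, add_zero] at hexp
    exact hexp

end Graph

section Decay

theorem norm_inner_le_of_mul_inner_eq {F : Type*} [NormedAddCommGroup F] [InnerProductSpace ℂ F]
    {φ ψ φ' ψ' : F} {d : ℂ} {a r M p q : ℝ} (ha : 0 ≤ a) (hr : 0 ≤ r) (hM : 0 ≤ M)
    (hd : ‖d‖ = r * a ^ 2) (h : d * inner ℂ φ ψ = inner ℂ φ' ψ - inner ℂ φ ψ')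
    (hφ : ‖φ‖ ≤ p) (hψ : ‖ψ‖ ≤ q) (hφ' : ‖φ'‖ ≤ a * M * p) (hψ' : ‖ψ'‖ ≤ a * M * q) :
    ‖inner ℂ φ ψ‖ ≤ (1 + 2 * M) / (1 + r * a) * (p * q) := by
  have hp : 0 ≤ p := (norm_nonneg φ).trans hφ
  have hq : 0 ≤ q := (norm_nonneg ψ).trans hψ
  have hbdd : ‖inner ℂ φ ψ‖ ≤ p * q := (norm_inner_le_norm φ ψ).trans (by gcongr)
  have hmul : a * (r * a * ‖inner ℂ φ ψ‖) ≤ a * (2 * M * (p * q)) :=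
    calc a * (r * a * ‖inner ℂ φ ψ‖) = ‖d * inner ℂ φ ψ‖ := by rw [norm_mul, hd]; ring
      _ ≤ ‖φ'‖ * ‖ψ‖ + ‖φ‖ * ‖ψ'‖ := by
        rw [h]
        exact (norm_sub_le _ _).trans (by gcongr <;> exact norm_inner_le_norm _ _)
      _ ≤ a * M * p * q + p * (a * M * q) := by gcongr
      _ = a * (2 * M * (p * q)) := by ring
  have hdecay : r * a * ‖inner ℂ φ ψ‖ ≤ 2 * M * (p * q) := by
    obtain rfl | ha := ha.eq_or_lt
    · rw [mul_zero, zero_mul]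
      positivity
    · exact le_of_mul_le_mul_left hmul ha
  rw [div_mul_eq_mul_div, le_div_iff₀ (by positivity)]
  linarith

variable (hω : Measurable ω) (hm : 0 < m) (hωm : ∀ᵐ k ∂μ, m ≤ ω k)
  {f g : Lp ℂ 2 μ} (hfg : f =ᵐ[μ] fun k => (ω k : ℂ) * g k)

include hω hfg in
/-- `a(g) U = U (a(g) + (β - γ) ‖g‖²)` for `U = W(βg) W(γg)⁻¹`. -/
theorem annihilateOnGraph_weyl_weyl_symm (β γ : ℂ) (p : (dGamma μ ω).graph) :
    ∃ q : (dGamma μ ω).graph,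
      (q : Fock μ × Fock μ).1 = weyl (β • g) ((weyl (γ • g)).symm (p : Fock μ × Fock μ).1) ∧
      annihilateOnGraph hm hωm g q =
        weyl (β • g) ((weyl (γ • g)).symm (annihilateOnGraph hm hωm g p)) +
          ((β - γ) * (‖g‖ ^ 2 : ℝ)) • (q : Fock μ × Fock μ).1 := by
  let r : (dGamma μ ω).graph :=
    ⟨_, weyl_symm_mem_graph hm hωm hω (smul_ae_eq_mul_smul hfg γ) p⟩
  let q : (dGamma μ ω).graph := ⟨_, weyl_mem_graph hm hωm hω (smul_ae_eq_mul_smul hfg β) r⟩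
  have hp := annihilateOnGraph_weyl hm hωm g (γ • g) r p ((weyl (γ • g)).apply_symm_apply _).symm
  have hq := annihilateOnGraph_weyl hm hωm g (β • g) r q rfl
  refine ⟨q, rfl, ?_⟩
  change _ = _ + _ • weyl (β • g) (r : Fock μ × Fock μ).1
  rw [hq, hp, LinearIsometryEquiv.symm_apply_apply]
  simp only [map_add, map_smul, inner_smul_right, inner_self_eq_norm_sq_to_K]
  push_cast
  module

include hω hm hωm hfg in
/-- In the inner product of `p` with `a(g) U q = U a(g) q + (β - γ) ‖g‖² U q`, where
`U = W(βg) W(γg)⁻¹`, all terms but the last are of order `‖g‖`. -/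
theorem norm_inner_weyl_weyl_symm_le (β γ : ℂ) (p q : (dGamma μ ω).graph) :
    ‖inner ℂ (p : Fock μ × Fock μ).1
      (weyl (β • g) ((weyl (γ • g)).symm (q : Fock μ × Fock μ).1))‖ ≤
      (1 + 2 * (1 + m⁻¹)) / (1 + ‖β - γ‖ * ‖g‖) * (‖p‖ * ‖q‖) := by
  obtain ⟨r, hr, har⟩ := annihilateOnGraph_weyl_weyl_symm hω hm hωm hfg β γ q
  have hiso (x : Fock μ) : ‖weyl (β • g) ((weyl (γ • g)).symm x)‖ = ‖x‖ :=
    (LinearIsometryEquiv.norm_map _ _).trans (LinearIsometryEquiv.norm_map _ _)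
  have hM : 0 ≤ 1 + m⁻¹ := by positivity
  rw [← hr]
  refine norm_inner_le_of_mul_inner_eq (d := (β - γ) * (‖g‖ ^ 2 : ℝ))
    (φ' := createOnGraph hm hωm g p)
    (ψ' := weyl (β • g) ((weyl (γ • g)).symm (annihilateOnGraph hm hωm g q)))
    (norm_nonneg _) (norm_nonneg _) hM ?_ ?_ (norm_fst_le _) ?_
    (norm_createOnGraph_le hm hωm g p) ?_
  · rw [norm_mul, Complex.norm_real, Real.norm_of_nonneg (sq_nonneg _)]
  · rw [inner_createOnGraph, har, inner_add_right, inner_smul_right, add_sub_cancel_left]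
  · exact (congrArg norm hr).trans_le ((hiso _).trans_le (norm_fst_le _))
  · exact (hiso _).trans_le (norm_annihilateOnGraph_le hm hωm g q)

end Decay

end Weyl

section Eigenbasis

variable {E : Type*} [NormedAddCommGroup E] [InnerProductSpace ℂ E]

section Normal

variable [CompleteSpace E] {T : E →L[ℂ] E} [IsStarNormal T]

theorem adjoint_apply_of_apply_eq_smul {β : ℂ} {x : E} (hx : T x = β • x) :
    ContinuousLinearMap.adjoint T x = starRingEnd ℂ β • x := by
  have hnormal : IsStarNormal (T - β • 1) :=
    Commute.isStarNormal_sub (by simp [(Commute.one_right T).smul_right])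
  have h := (ContinuousLinearMap.IsStarNormal.adjoint_apply_eq_zero_iff hnormal x).2 (by simp [hx])
  rw [← ContinuousLinearMap.star_eq_adjoint, star_sub, star_smul, star_one] at h
  simpa [sub_eq_zero, ContinuousLinearMap.star_eq_adjoint] using h

theorem orthogonalFamily_eigenspace :
    OrthogonalFamily ℂ (fun β => Module.End.eigenspace (T : E →ₗ[ℂ] E) β)
      fun β => (Module.End.eigenspace (T : E →ₗ[ℂ] E) β).subtypeₗᵢ := by
  rintro β γ hβγ ⟨x, hx⟩ ⟨y, hy⟩
  have hx : T x = β • x := Module.End.mem_eigenspace_iff.1 hx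
  have hy : T y = γ • y := Module.End.mem_eigenspace_iff.1 hy
  have h : β * inner ℂ x y = γ * inner ℂ x y := by
    have := ContinuousLinearMap.adjoint_inner_left T y x
    rwa [adjoint_apply_of_apply_eq_smul hx, hy, inner_smul_left, inner_smul_right,
      Complex.conj_conj] at this
  exact (mul_eq_mul_right_iff.1 h).resolve_left hβγ

end Normal

variable [FiniteDimensional ℂ E]

theorem orthogonal_iSup_eigenspace_eq_bot [CompleteSpace E] (T : E →L[ℂ] E) [IsStarNormal T] :
    (⨆ β : ℂ, Module.End.eigenspace (T : E →ₗ[ℂ] E) β)ᗮ = ⊥ := by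
  set S := ⨆ β : ℂ, Module.End.eigenspace (T : E →ₗ[ℂ] E) β with hS
  have hinv : ∀ y ∈ Sᗮ, (T : E →ₗ[ℂ] E) y ∈ Sᗮ := by
    rw [hS, ← Submodule.iInf_orthogonal]
    refine (T : E →ₗ[ℂ] E).iInf_invariant fun β y hy x hx => ?_
    change inner ℂ x (T y) = 0
    rw [← ContinuousLinearMap.adjoint_inner_left,
      adjoint_apply_of_apply_eq_smul (Module.End.mem_eigenspace_iff.1 hx), inner_smul_left,
      hy x hx, mul_zero]
  by_contra hne
  have : Nontrivial Sᗮ := Submodule.nontrivial_iff_ne_bot.2 hne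
  obtain ⟨β, hβ⟩ := Module.End.exists_eigenvalue ((T : E →ₗ[ℂ] E).restrict hinv)
  obtain ⟨v, hv⟩ := hβ.exists_hasEigenvector
  have hvS : (v : E) ∈ S := Submodule.mem_iSup_of_mem β
    (Module.End.mem_eigenspace_iff.2 (congrArg Subtype.val hv.apply_eq_smul))
  exact hv.2 (Subtype.ext (inner_self_eq_zero.1 (v.2 _ hvS)))

/-- A symmetric operator need not preserve an orthogonal decomposition, but its compressions to the
summands can be diagonalised simultaneously. -/
theorem exists_orthonormalBasis_subordinate {ι : Type*} [Finite ι] [DecidableEq ι]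
    {V : ι → Submodule ℂ E} (hV : OrthogonalFamily ℂ (fun i => V i) fun i => (V i).subtypeₗᵢ)
    (hint : DirectSum.IsInternal V) {K : E →ₗ[ℂ] E} (hK : K.IsSymmetric) {n : ℕ}
    (hn : Module.finrank ℂ E = n) :
    ∃ (u : OrthonormalBasis (Fin n) ℂ E) (i : Fin n → ι), (∀ j, u j ∈ V (i j)) ∧
      ∀ j k, j ≠ k → i j = i k → inner ℂ (u j) (K (u k)) = 0 := by
  have := Fintype.ofFinite ι
  have hsymm (i : ι) :
      (LinearMap.adjoint (V i).subtype ∘ₗ K ∘ₗ (V i).subtype).IsSymmetric := hK.adjoint_conj _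
  let b := hint.collectedOrthonormalBasis hV fun i => (hsymm i).eigenvectorBasis rfl
  have hb (a) : b a = ((hsymm a.1).eigenvectorBasis rfl a.2 : E) := by
    simp [b, DirectSum.IsInternal.collectedOrthonormalBasis]
  have hoffdiag (a c) (hac : a ≠ c) (hi : a.1 = c.1) : inner ℂ (b a) (K (b c)) = 0 := by
    obtain ⟨i, j⟩ := a
    obtain ⟨_, k⟩ := c
    obtain rfl : i = _ := hi
    have hjk : j ≠ k := fun h => hac (congrArg _ h)
    have := (hsymm i).apply_eigenvectorBasis rfl k
    rw [hb, hb]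
    change inner ℂ ((V i).subtype _) _ = 0
    rw [← LinearMap.adjoint_inner_right]
    change inner ℂ _ ((LinearMap.adjoint (V i).subtype ∘ₗ K ∘ₗ (V i).subtype) _) = 0
    rw [this, inner_smul_right, OrthonormalBasis.inner_eq_ite, if_neg hjk, mul_zero]
  let e := Fintype.equivFinOfCardEq ((Module.finrank_eq_card_basis b.toBasis).symm.trans hn)
  refine ⟨b.reindex e, fun j => (e.symm j).1, fun j => ?_, fun j k hjk hi => ?_⟩
  · rw [OrthonormalBasis.reindex_apply, hb]
    exact Subtype.mem _
  · rw [OrthonormalBasis.reindex_apply, OrthonormalBasis.reindex_apply]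
    exact hoffdiag _ _ (e.symm.injective.ne hjk) hi

theorem exists_orthonormalBasis_eigenvectors [CompleteSpace E] (T : E →L[ℂ] E) [IsStarNormal T]
    {K : E →ₗ[ℂ] E} (hK : K.IsSymmetric) {n : ℕ} (hn : Module.finrank ℂ E = n) :
    ∃ (u : OrthonormalBasis (Fin n) ℂ E) (β : Fin n → ℂ), (∀ j, T (u j) = β j • u j) ∧
      ∀ j k, j ≠ k → β j = β k → inner ℂ (u j) (K (u k)) = 0 := by
  classical
  have hV : OrthogonalFamily ℂ
      (fun β : Module.End.Eigenvalues (T : E →ₗ[ℂ] E) => Module.End.eigenspace (T : E →ₗ[ℂ] E) β)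
      fun β => (Module.End.eigenspace (T : E →ₗ[ℂ] E) β).subtypeₗᵢ :=
    orthogonalFamily_eigenspace.comp Subtype.coe_injective
  have hint : DirectSum.IsInternal fun β : Module.End.Eigenvalues (T : E →ₗ[ℂ] E) =>
      Module.End.eigenspace (T : E →ₗ[ℂ] E) β := by
    rw [hV.isInternal_iff, ← orthogonal_iSup_eigenspace_eq_bot T]
    exact congrArg _ (iSup_ne_bot_subtype _)
  obtain ⟨u, i, hu, hoffdiag⟩ := exists_orthonormalBasis_subordinate hV hint hK hn
  exact ⟨u, fun j => i j, fun j => Module.End.mem_eigenspace_iff.1 (hu j),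
    fun j k hjk hβ => hoffdiag j k hjk (Subtype.ext hβ)⟩

open Matrix in
theorem exists_unitary_diagonalization {D : ℕ} {K B : Matrix (Fin D) (Fin D) ℂ}
    (hK : K.IsHermitian) [IsStarNormal B] :
    ∃ (U : unitaryGroup (Fin D) ℂ) (β : Fin D → ℂ), Unitary.conjStarAlgAut ℂ _ U B = diagonal β ∧
      ∀ j k, j ≠ k → β j = β k → Unitary.conjStarAlgAut ℂ _ U K j k = 0 := by
  obtain ⟨u, β, hu, hoffdiag⟩ := exists_orthonormalBasis_eigenvectors
    (toEuclideanCLM (n := Fin D) (𝕜 := ℂ) B) (isSymmetric_toEuclideanLin_iff.2 hK)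
    finrank_euclideanSpace_fin
  let P : unitaryGroup (Fin D) ℂ := ⟨(EuclideanSpace.basisFun (Fin D) ℂ).toBasis.toMatrix u,
    OrthonormalBasis.toMatrix_orthonormalBasis_mem_unitary _ _⟩
  have hP (M : Matrix (Fin D) (Fin D) ℂ) (j k : Fin D) :
      Unitary.conjStarAlgAut ℂ _ (star P) M j k = inner ℂ (u j) (toEuclideanLin M (u k)) := by
    rw [Unitary.conjStarAlgAut_apply, Unitary.coe_star, star_star, mul_mul_apply,
      EuclideanSpace.inner_eq_star_dotProduct, dotProduct_comm]
    rfl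
  refine ⟨star P, β, ?_, fun j k hjk hβ => (hP K j k).trans (hoffdiag j k hjk hβ)⟩
  ext j k
  have := hu k
  change toEuclideanLin B (u k) = _ at this
  rw [hP, this, inner_smul_right, OrthonormalBasis.inner_eq_ite, diagonal_apply]
  split_ifs with h <;> simp [h]

end Eigenbasis

section SpinOperators

variable {D : ℕ} {F : Type*} [NormedAddCommGroup F] [InnerProductSpace ℂ F]

section Conj

variable (W : F ≃ₗᵢ[ℂ] F) (A A' : F →ₗ.[ℂ] F)

theorem conj_trans (W' : F ≃ₗᵢ[ℂ] F) : conj (W.trans W') A = conj W' (conj W A) := rfl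

theorem conj_add : conj W (A + A') = conj W A + conj W A' :=
  LinearPMap.ext rfl fun _ _ _ => map_add W _ _

theorem conj_sub : conj W (A - A') = conj W A - conj W A' :=
  LinearPMap.ext rfl fun _ _ _ => map_sub W _ _

theorem conj_vadd [CompleteSpace F] (S : F →L[ℂ] F) :
    conj W ((S : F →ₗ[ℂ] F) +ᵥ A) = (W.conjStarAlgEquiv S : F →ₗ[ℂ] F) +ᵥ conj W A :=
  LinearPMap.ext rfl fun _ _ _ => map_add W _ _

variable [CompleteSpace F]

theorem isSelfAdjoint_conjStarAlgEquiv_sub {S T : F →L[ℂ] F} (hS : IsSelfAdjoint S)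
    (hT : IsSelfAdjoint T) : IsSelfAdjoint (W.conjStarAlgEquiv S - T) :=
  (hS.map W.conjStarAlgEquiv).sub hT

theorem norm_conjStarAlgEquiv_sub_le (S T : F →L[ℂ] F) :
    ‖W.conjStarAlgEquiv S - T‖ ≤ ‖S‖ + ‖T‖ :=
  (norm_sub_le _ _).trans <|
    add_le_add (NonUnitalStarAlgHom.norm_apply_le W.conjStarAlgEquiv S) le_rfl

end Conj

theorem vadd_add (S : F →ₗ[ℂ] F) (A A' : F →ₗ.[ℂ] F) : (S +ᵥ A) + A' = S +ᵥ (A + A') :=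
  LinearPMap.ext rfl fun _ _ _ => add_assoc _ _ _

theorem vadd_sub (S : F →ₗ[ℂ] F) (A A' : F →ₗ.[ℂ] F) : (S +ᵥ A) - A' = S +ᵥ (A - A') :=
  LinearPMap.ext rfl fun _ _ _ => add_sub_assoc _ _ _

section SpinAct

variable (M N : Matrix (Fin D) (Fin D) ℂ) {A : F →ₗ.[ℂ] F}

theorem spinTensor_apply (Ψ : (spinTensor M A).domain) (i : Fin D) :
    spinTensor M A Ψ i = ∑ j, M i j • A ⟨(Ψ : Spin D F) j, Ψ.2 j⟩ := rfl

variable [CompleteSpace F]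

variable (D F) in
/-- The representation `M ↦ M ⊗ 1` of `D × D` matrices on `ℂ^D ⊗ F`. -/
def spinAct : Matrix (Fin D) (Fin D) ℂ →⋆ₐ[ℂ] (Spin D F →L[ℂ] Spin D F) where
  toFun M := ((PiLp.continuousLinearEquiv 2 ℂ (fun _ : Fin D => F)).symm :
      (Fin D → F) →L[ℂ] Spin D F) ∘L
    (ContinuousLinearMap.pi fun i => ∑ j, M i j • ContinuousLinearMap.proj j) ∘L
      (PiLp.continuousLinearEquiv 2 ℂ (fun _ : Fin D => F) : Spin D F →L[ℂ] (Fin D → F))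
  map_one' := by
    ext Ψ i
    simp [Matrix.one_apply]
  map_mul' M N := by
    ext Ψ i
    simp only [Matrix.mul_apply]
    simpa [Finset.sum_smul, Finset.smul_sum, smul_smul] using! Finset.sum_comm
  map_zero' := by
    ext Ψ i
    simp
  map_add' M N := by
    ext Ψ i
    simp [add_smul, Finset.sum_add_distrib]
  commutes' c := by
    ext Ψ i
    simp [Matrix.algebraMap_matrix_apply]
  map_star' M := by
    rw [ContinuousLinearMap.star_eq_adjoint, ContinuousLinearMap.eq_adjoint_iff]
    intro Ψ Φ
    simpa [PiLp.inner_apply, sum_inner, inner_sum, inner_smul_left, inner_smul_right,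
      Matrix.star_apply] using Finset.sum_comm

theorem spinAct_apply (Ψ : Spin D F) (i : Fin D) : spinAct D F M Ψ i = ∑ j, M i j • Ψ j := by
  simp [spinAct]

theorem spinTensor_idOp_add (A : Spin D F →ₗ.[ℂ] Spin D F) :
    spinTensor M (idOp F) + A = (spinAct D F M : Spin D F →ₗ[ℂ] Spin D F) +ᵥ A := by
  refine LinearPMap.ext ?_ fun Ψ _ _ => ?_
  · exact inf_eq_right.2 fun _ _ _ => Submodule.mem_top
  · refine congrArg (· + A _) (PiLp.ext fun i => ?_)
    exact (spinAct_apply M Ψ i).symm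

theorem spinAct_mem {p : Submodule ℂ F} {Ψ : Spin D F} (hΨ : ∀ j, Ψ j ∈ p) (i : Fin D) :
    spinAct D F M Ψ i ∈ p := by
  rw [spinAct_apply]
  exact p.sum_mem fun j _ => p.smul_mem _ (hΨ j)

theorem spinAct_spinTensor (Ψ : (spinTensor M A).domain) :
    spinAct D F N (spinTensor M A Ψ) = spinTensor (N * M) A ⟨Ψ, Ψ.2⟩ := by
  ext i
  simp only [spinAct_apply, spinTensor_apply, Matrix.mul_apply, Finset.sum_smul, Finset.smul_sum,
    smul_smul]
  exact Finset.sum_comm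

theorem spinTensor_spinAct (Ψ : (spinTensor M A).domain) :
    spinTensor M A ⟨spinAct D F N (Ψ : Spin D F), spinAct_mem N Ψ.2⟩ =
      spinTensor (M * N) A ⟨Ψ, Ψ.2⟩ := by
  have h (j : Fin D) : A ⟨spinAct D F N (Ψ : Spin D F) j, spinAct_mem N Ψ.2 j⟩ =
      ∑ k, N j k • A ⟨(Ψ : Spin D F) k, Ψ.2 k⟩ := by
    have hsum : (⟨spinAct D F N (Ψ : Spin D F) j, spinAct_mem N Ψ.2 j⟩ : A.domain) =
        ∑ k, N j k • ⟨(Ψ : Spin D F) k, Ψ.2 k⟩ := Subtype.ext (by simp [spinAct_apply])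
    rw [hsum, ← LinearPMap.toFun_eq_coe, map_sum]
    simp only [map_smul, LinearPMap.toFun_eq_coe]
  ext i
  simp only [spinTensor_apply, h, Matrix.mul_apply, Finset.sum_smul, Finset.smul_sum, smul_smul]
  exact Finset.sum_comm

/-- The unitary operator `U ⊗ 1` on `ℂ^D ⊗ F`. -/
def spinRotation (U : Matrix.unitaryGroup (Fin D) ℂ) : Spin D F ≃ₗᵢ[ℂ] Spin D F :=
  Unitary.linearIsometryEquiv ⟨spinAct D F U, Unitary.map_mem (spinAct D F) U.2⟩

theorem conj_spinRotation_spinTensor (U : Matrix.unitaryGroup (Fin D) ℂ) (A : F →ₗ.[ℂ] F) :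
    conj (spinRotation U) (spinTensor M A) = spinTensor (Unitary.conjStarAlgAut ℂ _ U M) A := by
  have hsymm (Ψ : Spin D F) : (spinRotation U).symm Ψ = spinAct D F (star U.1) Ψ :=
    congrArg (· Ψ) (map_star (spinAct D F) U.1).symm
  have hdomain (Ψ : Spin D F) :
      (spinRotation U).symm Ψ ∈ (spinTensor M A).domain ↔ Ψ ∈ (spinTensor M A).domain := by
    refine ⟨fun h => ?_, fun h => hsymm Ψ ▸ spinAct_mem _ h⟩
    rw [← (spinRotation U).apply_symm_apply Ψ]
    exact spinAct_mem (Ψ := (spinRotation U).symm Ψ) U.1 h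
  refine LinearPMap.ext (Submodule.ext hdomain) fun Ψ hΨ' hΨ => ?_
  calc spinAct D F U (spinTensor M A ⟨(spinRotation U).symm Ψ, hΨ'⟩)
    _ = spinAct D F U (spinTensor M A ⟨spinAct D F (star U.1) Ψ, spinAct_mem _ hΨ⟩) := by
        simp only [hsymm]
    _ = spinAct D F U (spinTensor (M * star U.1) A ⟨Ψ, hΨ⟩) := by
        rw [← spinTensor_spinAct (star U.1) (M := M) ⟨Ψ, hΨ⟩]
    _ = spinTensor (U.1 * (M * star U.1)) A ⟨Ψ, hΨ⟩ := spinAct_spinTensor _ _ _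
    _ = spinTensor (Unitary.conjStarAlgAut ℂ _ U M) A ⟨Ψ, hΨ⟩ :=
        congrArg (fun N => spinTensor N A ⟨Ψ, hΨ⟩) (mul_assoc _ _ _).symm

end SpinAct

section DirectSum

/-- The operator `⨁ⱼ Aⱼ` on `ℂ^D ⊗ F`, acting on the `j`-th component as `Aⱼ`. -/
def directSum (A : Fin D → F →ₗ.[ℂ] F) : Spin D F →ₗ.[ℂ] Spin D F where
  domain :=
    { carrier := {Ψ | ∀ j, Ψ j ∈ (A j).domain}
      zero_mem' := fun j => (A j).domain.zero_mem
      add_mem' := fun ha hb j => (A j).domain.add_mem (ha j) (hb j)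
      smul_mem' := fun c _ ha j => (A j).domain.smul_mem c (ha j) }
  toFun :=
    { toFun := fun Ψ => WithLp.toLp 2 fun j => A j ⟨(Ψ : Spin D F) j, Ψ.2 j⟩
      map_add' := fun Ψ Φ => by
        ext j
        exact (A j).map_add ⟨_, Ψ.2 j⟩ ⟨_, Φ.2 j⟩
      map_smul' := fun c Ψ => by
        ext j
        exact (A j).map_smul c ⟨_, Ψ.2 j⟩ }

variable (A A' : Fin D → F →ₗ.[ℂ] F)

theorem directSum_add : directSum A + directSum A' = directSum (A + A') :=
  LinearPMap.ext (Submodule.ext fun _ => forall_and.symm) fun _ _ _ => rfl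

theorem directSum_sub : directSum A - directSum A' = directSum (A - A') :=
  LinearPMap.ext (Submodule.ext fun _ => forall_and.symm) fun _ _ _ => rfl

theorem conj_directSum (W : Fin D → F ≃ₗᵢ[ℂ] F) :
    conj (LinearIsometryEquiv.piLpCongrRight 2 W) (directSum A) =
      directSum fun j => conj (W j) (A j) :=
  LinearPMap.ext rfl fun _ _ _ => rfl

theorem spinTensor_diagonal (d : Fin D → ℂ) (A : F →ₗ.[ℂ] F) :
    spinTensor (Matrix.diagonal d) A = directSum fun j => d j • A := by
  refine LinearPMap.ext rfl fun Ψ _ _ => PiLp.ext fun i => ?_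
  rw [spinTensor_apply, Finset.sum_eq_single i]
  · rw [Matrix.diagonal_apply_eq]
    rfl
  · intro j _ hji
    rw [Matrix.diagonal_apply_ne' _ hji, zero_smul]
  · simp

theorem spinTensor_one (A : F →ₗ.[ℂ] F) :
    spinTensor (1 : Matrix (Fin D) (Fin D) ℂ) A = directSum fun _ => A := by
  simp only [← Matrix.diagonal_one, spinTensor_diagonal, one_smul]

variable {A}

theorem mem_graph_directSum {Ψ Θ : Spin D F} :
    (Ψ, Θ) ∈ (directSum A).graph ↔ ∀ j, (Ψ j, Θ j) ∈ (A j).graph := by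
  constructor
  · intro h j
    obtain ⟨Φ, rfl, rfl⟩ := (LinearPMap.mem_graph_iff _).1 h
    exact (A j).mem_graph ⟨(Φ : Spin D F) j, Φ.2 j⟩
  · intro h
    have hdomain : Ψ ∈ (directSum A).domain := fun j => LinearPMap.mem_domain_of_mem_graph (h j)
    refine (LinearPMap.image_iff hdomain).1 (PiLp.ext fun j => ?_)
    exact (LinearPMap.image_iff (hdomain j)).2 (h j)

theorem isSelfAdjoint_directSum [CompleteSpace F] (hA : ∀ j, IsSelfAdjoint (A j)) :
    IsSelfAdjoint (directSum A) := by
  rw [isSelfAdjoint_iff_adjoint_graph_eq]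
  ext ⟨Ψ, Θ⟩
  rw [mem_adjoint_iff_inner_eq, mem_graph_directSum]
  constructor
  · intro h j
    rw [← isSelfAdjoint_iff_adjoint_graph_eq.1 (hA j), mem_adjoint_iff_inner_eq]
    intro a b hab
    have hsingle (i : Fin D) :
        (Pi.single (M := fun _ => F) j a i, Pi.single (M := fun _ => F) j b i) ∈ (A i).graph := by
      rcases eq_or_ne i j with rfl | hij
      · simpa using hab
      · simp [hij]
    have hinner (u : F) (Φ : Spin D F) :
        inner ℂ (WithLp.toLp 2 (Pi.single j u) : Spin D F) Φ = inner ℂ u (Φ j) := by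
      rw [PiLp.inner_apply, Finset.sum_eq_single j]
      · simp
      · intro i _ hij
        simp [hij]
      · simp
    simpa only [hinner] using h (WithLp.toLp 2 (Pi.single j a)) (WithLp.toLp 2 (Pi.single j b))
      (mem_graph_directSum.2 hsingle)
  · intro h Φ Ξ hΦ
    simp only [PiLp.inner_apply]
    exact Finset.sum_congr rfl fun j _ =>
      inner_eq_inner_of_mem_graph (hA j) (mem_graph_directSum.1 hΦ j) (h j)

theorem GraphFormBound.const_smul {A : F →ₗ.[ℂ] F} {V : F →L[ℂ] F} {ε : ℝ}
    (hV : GraphFormBound A V ε) (c : ℂ) : GraphFormBound A (c • V) (‖c‖ * ε) := by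
  intro a b x y hab hxy
  rw [smul_apply, inner_smul_right, norm_mul, mul_assoc]
  gcongr
  exact hV a b x y hab hxy

theorem graphFormBound_directSum {A : F →ₗ.[ℂ] F} {T : Spin D F →L[ℂ] Spin D F}
    {V : Fin D → Fin D → F →L[ℂ] F} (hT : ∀ Ψ j, T Ψ j = ∑ k, V j k (Ψ k))
    {ε : Fin D → Fin D → ℝ} (hε : ∀ j k, 0 ≤ ε j k) (hV : ∀ j k, GraphFormBound A (V j k) (ε j k)) :
    GraphFormBound (directSum fun _ => A) T (∑ j, ∑ k, ε j k) := by
  intro Ψ Θ Φ Ξ hΨ hΦ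
  rw [PiLp.inner_apply, Finset.sum_mul]
  refine norm_sum_le_of_le _ fun j _ => ?_
  rw [hT, inner_sum, Finset.sum_mul]
  refine norm_sum_le_of_le _ fun k _ => ?_
  calc ‖inner ℂ (Ψ j) (V j k (Φ k))‖ ≤ ε j k * ((‖Ψ j‖ + ‖Θ j‖) * (‖Φ k‖ + ‖Ξ k‖)) :=
        hV j k _ _ _ _ (mem_graph_directSum.1 hΨ j) (mem_graph_directSum.1 hΦ k)
    _ ≤ ε j k * ((‖Ψ‖ + ‖Θ‖) * (‖Φ‖ + ‖Ξ‖)) := by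
        have := hε j k
        gcongr <;> apply PiLp.norm_apply_le

end DirectSum

end SpinOperators

section Hamiltonian

variable {X : Type*} [MeasurableSpace X] {μ : Measure X} {ω : X → ℝ} {m : ℝ}

/-- The ground state energy `-∫ |f|² / ω` of the van Hove Hamiltonian `dΓ(ω) + a*(f) + a(f)`. -/
def groundEnergy (ω : X → ℝ) (f : Lp ℂ 2 μ) : ℂ :=
  -∫ k, (starRingEnd ℂ) (f k) * f k / (ω k : ℂ) ∂μ

theorem groundEnergy_smul (c : ℂ) (f : Lp ℂ 2 μ) :
    groundEnergy ω (c • f) = starRingEnd ℂ c * c * groundEnergy ω f := by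
  rw [groundEnergy, groundEnergy, mul_neg, ← integral_const_mul]
  congr 1
  refine integral_congr_ae ?_
  filter_upwards [Lp.coeFn_smul c f] with k hk
  rw [hk, Pi.smul_apply, smul_eq_mul, map_mul]
  ring

theorem groundEnergy_eq_inner {f g : Lp ℂ 2 μ} (hfg : f =ᵐ[μ] fun k => (ω k : ℂ) * g k) :
    groundEnergy ω f = -((inner ℂ f g + inner ℂ g f) / 2) := by
  have h₁ : inner ℂ f g = ∫ k, (starRingEnd ℂ) (f k) * f k / (ω k : ℂ) ∂μ := by
    rw [L2.inner_def]
    refine integral_congr_ae ?_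
    filter_upwards [hfg] with k hk
    rcases eq_or_ne (ω k : ℂ) 0 with h | h
    · simp [hk, h]
    · rw [hk, RCLike.inner_apply, eq_div_iff h]
      ring
  have h₂ : inner ℂ g f = inner ℂ f g := by
    rw [L2.inner_def, L2.inner_def]
    refine integral_congr_ae ?_
    filter_upwards [hfg] with k hk
    rw [hk, RCLike.inner_apply, RCLike.inner_apply, map_mul, Complex.conj_ofReal]
    ring
  rw [groundEnergy, h₂, h₁, add_self_div_two]

variable {D : ℕ} (K B : Matrix (Fin D) (Fin D) ℂ) (β : Fin D → ℂ) (f : Lp ℂ 2 μ)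

theorem selfEnergy_diagonal : selfEnergy ω (Matrix.diagonal β) f =
    Matrix.diagonal fun j => groundEnergy ω (β j • f) := by
  rw [selfEnergy, Matrix.diagonal_conjTranspose, Matrix.diagonal_mul_diagonal, ← neg_smul,
    ← Matrix.diagonal_smul]
  congr 1
  funext j
  rw [groundEnergy_smul, Pi.smul_apply, smul_eq_mul, mul_comm]
  rfl

theorem selfEnergy_conjStarAlgAut (U : Matrix.unitaryGroup (Fin D) ℂ) :
    selfEnergy ω (Unitary.conjStarAlgAut ℂ _ U B) f =
      Unitary.conjStarAlgAut ℂ _ U (selfEnergy ω B f) := by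
  simp only [selfEnergy, ← Matrix.star_eq_conjTranspose, map_neg, map_smul, map_mul, map_star]

variable [SigmaFinite μ]

/-- The renormalised van Hove Hamiltonian `dΓ(ω) + a*(f) + a(f) + ∫ |f|² / ω`. -/
def vanHove (ω : X → ℝ) (f : Lp ℂ 2 μ) : Fock μ →ₗ.[ℂ] Fock μ :=
  dGamma μ ω + (create f + annihilate f) - groundEnergy ω f • idOp (Fock μ)

theorem conj_weyl_vanHove (hω : Measurable ω) (hm : 0 < m) (hωm : ∀ᵐ k ∂μ, m ≤ ω k)
    {g : Lp ℂ 2 μ} (hfg : f =ᵐ[μ] fun k => (ω k : ℂ) * g k) :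
    conj (weyl g) (vanHove ω f) = dGamma μ ω := by
  have hmem (x : Fock μ) (hx : (weyl g).symm x ∈ (vanHove ω f).domain) :
      (x, weyl g (vanHove ω f ⟨(weyl g).symm x, hx⟩)) ∈ (dGamma μ ω).graph := by
    have := weyl_mem_graph hm hωm hω hfg ⟨_, (dGamma μ ω).mem_graph ⟨_, hx.1.1⟩⟩
    rw [← neg_neg (_ / 2 : ℂ), ← groundEnergy_eq_inner hfg, neg_smul, ← sub_eq_add_neg] at this
    simpa only [LinearIsometryEquiv.apply_symm_apply] using! this
  have hdomain (x : Fock μ) (hx : x ∈ (dGamma μ ω).domain) :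
      (weyl g).symm x ∈ (vanHove ω f).domain := by
    have := weyl_symm_mem_graph hm hωm hω hfg ⟨_, (dGamma μ ω).mem_graph ⟨x, hx⟩⟩
    have hnumber := mem_domSqrtNumber_of_mem_graph hm hωm this
    exact ⟨⟨LinearPMap.mem_domain_of_mem_graph this, hnumber, hnumber⟩, Submodule.mem_top⟩
  refine LinearPMap.ext (Submodule.ext fun x => ⟨fun hx => ?_, hdomain x⟩) fun x hx hx' => ?_
  · exact LinearPMap.mem_domain_of_mem_graph (hmem x hx)
  · exact (LinearPMap.image_iff hx').2 (hmem x hx)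

theorem hamiltonian_diagonal_sub_selfEnergy :
    hamiltonian ω K (Matrix.diagonal β) f -
        spinTensor (selfEnergy ω (Matrix.diagonal β) f) (idOp (Fock μ)) =
      (spinAct D (Fock μ) K : Spin D (Fock μ) →ₗ[ℂ] Spin D (Fock μ)) +ᵥ
        directSum fun j => vanHove ω (β j • f) := by
  rw [hamiltonian, selfEnergy_diagonal, Matrix.diagonal_conjTranspose, spinTensor_idOp_add,
    spinTensor_one]
  simp only [spinTensor_diagonal, vadd_add, vadd_sub, directSum_add, directSum_sub, vanHove,
    create_smul, annihilate_smul]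
  rfl

theorem conj_spinRotation_hamiltonian (U : Matrix.unitaryGroup (Fin D) ℂ) :
    conj (spinRotation U) (hamiltonian ω K B f) =
      hamiltonian ω (Unitary.conjStarAlgAut ℂ _ U K) (Unitary.conjStarAlgAut ℂ _ U B) f := by
  simp only [hamiltonian, conj_add, conj_spinRotation_spinTensor, map_one,
    ← Matrix.star_eq_conjTranspose, map_star]

/-- The dressing transformation `⨁ⱼ W(βⱼ g)` of the Hamiltonian with coupling `diag(β)`. -/
def dressing (β : Fin D → ℂ) (g : Lp ℂ 2 μ) : Spin D (Fock μ) ≃ₗᵢ[ℂ] Spin D (Fock μ) :=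
  .piLpCongrRight 2 fun j => weyl (β j • g)

variable {B β f}

theorem conj_dressing_hamiltonian (hω : Measurable ω) (hm : 0 < m) (hωm : ∀ᵐ k ∂μ, m ≤ ω k)
    {g : Lp ℂ 2 μ} (hfg : f =ᵐ[μ] fun k => (ω k : ℂ) * g k)
    {U : Matrix.unitaryGroup (Fin D) ℂ}
    (hB : Unitary.conjStarAlgAut ℂ _ U B = Matrix.diagonal β) :
    conj ((spinRotation U).trans (dressing β g))
        (hamiltonian ω K B f - spinTensor (selfEnergy ω B f) (idOp (Fock μ))) =
      ((dressing β g).conjStarAlgEquiv (spinAct D (Fock μ) (Unitary.conjStarAlgAut ℂ _ U K)) :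
        Spin D (Fock μ) →ₗ[ℂ] Spin D (Fock μ)) +ᵥ directSum fun _ => dGamma μ ω := by
  rw [conj_trans, conj_sub, conj_spinRotation_hamiltonian, conj_spinRotation_spinTensor,
    ← selfEnergy_conjStarAlgAut, hB, hamiltonian_diagonal_sub_selfEnergy, conj_vadd,
    dressing, conj_directSum]
  simp only [fun j => conj_weyl_vanHove (β j • f) hω hm hωm (smul_ae_eq_mul_smul hfg (β j))]

end Hamiltonian

section Limit

variable {X : Type*} [MeasurableSpace X] {μ : Measure X} {ω : X → ℝ} {m : ℝ}

theorem exists_div_dispersion (hω : Measurable ω) (hm : 0 < m) (hωm : ∀ᵐ k ∂μ, m ≤ ω k)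
    (f : Lp ℂ 2 μ) : ∃ g : Lp ℂ 2 μ, (g =ᵐ[μ] fun k => ((ω k)⁻¹ : ℂ) * f k) ∧
      (f =ᵐ[μ] fun k => (ω k : ℂ) * g k) := by
  have hL : MemLp (fun k => ((ω k)⁻¹ : ℂ) * f k) 2 μ := by
    refine (Lp.memLp f).of_le_mul (c := m⁻¹) ?_ ?_
    · have : Measurable fun k => ((ω k)⁻¹ : ℂ) := by fun_prop
      exact this.aestronglyMeasurable.mul (Lp.aestronglyMeasurable f)
    · filter_upwards [hωm] with k hk
      rw [norm_mul, norm_inv, Complex.norm_real, Real.norm_of_nonneg (hm.le.trans hk)]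
      gcongr
  refine ⟨hL.toLp _, hL.coeFn_toLp, ?_⟩
  filter_upwards [hL.coeFn_toLp, hωm] with k hg hk
  rw [hg, mul_inv_cancel_left₀ (Complex.ofReal_ne_zero.2 (hm.trans_le hk).ne')]

theorem tendsto_norm_of_tendsto_eLpNorm {g : ℕ → Lp ℂ 2 μ} {h : ℕ → X → ℂ}
    (hg : ∀ n, g n =ᵐ[μ] h n) (hh : Tendsto (fun n => eLpNorm (h n) 2 μ) atTop (𝓝 ∞)) :
    Tendsto (fun n => ‖g n‖) atTop atTop := by
  rw [← ENNReal.tendsto_ofReal_nhds_top]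
  refine hh.congr fun n => ?_
  rw [ofReal_norm, Lp.enorm_def]
  exact (eLpNorm_congr_ae (hg n)).symm

variable {D : ℕ} {M : Matrix (Fin D) (Fin D) ℂ} {β : Fin D → ℂ}

theorem isHermitian_diagonal_diag (hM : M.IsHermitian) : (Matrix.diagonal M.diag).IsHermitian :=
  Matrix.isHermitian_diagonal_of_self_adjoint _ (funext fun j => hM.apply j j)

/-- Bound on `W (M ⊗ 1) W* - diag(M) ⊗ 1` as a form on the graph of `dΓ(ω)`, for the dressing
transformation `W = ⨁ⱼ W(βⱼ g)` with `‖g‖ = r` and `ω ≥ m`. -/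
def decayRate (m : ℝ) (M : Matrix (Fin D) (Fin D) ℂ) (β : Fin D → ℂ) (r : ℝ) : ℝ :=
  ∑ j, ∑ k, if β j = β k then 0 else ‖M j k‖ * ((1 + 2 * (1 + m⁻¹)) / (1 + ‖β j - β k‖ * r))

theorem tendsto_decayRate (m : ℝ) (M : Matrix (Fin D) (Fin D) ℂ) (β : Fin D → ℂ) :
    Tendsto (decayRate m M β) atTop (𝓝 0) := by
  have hzero : (0 : ℝ) = ∑ _j : Fin D, ∑ _k : Fin D, (0 : ℝ) := by simp
  rw [hzero]
  refine tendsto_finsetSum _ fun j _ => tendsto_finsetSum _ fun k _ => ?_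
  split_ifs with h
  · exact tendsto_const_nhds
  · have hpos : 0 < ‖β j - β k‖ := norm_pos_iff.2 (sub_ne_zero.2 h)
    have hdenom : Tendsto (fun r : ℝ => 1 + ‖β j - β k‖ * r) atTop atTop :=
      tendsto_atTop_add_const_left _ _ (tendsto_id.const_mul_atTop hpos)
    simpa using (hdenom.const_div_atTop (1 + 2 * (1 + m⁻¹))).const_mul ‖M j k‖

variable [SigmaFinite μ]

/-- The remainder `W (M ⊗ 1) W* - diag(M) ⊗ 1` of the dressing transformation `W = ⨁ⱼ W(βⱼ g)`. -/
def dressingRemainder (M : Matrix (Fin D) (Fin D) ℂ) (β : Fin D → ℂ) (g : Lp ℂ 2 μ) :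
    Spin D (Fock μ) →L[ℂ] Spin D (Fock μ) :=
  (dressing β g).conjStarAlgEquiv (spinAct D (Fock μ) M) -
    spinAct D (Fock μ) (Matrix.diagonal M.diag)

theorem dressingRemainder_apply (hMβ : ∀ j k, j ≠ k → β j = β k → M j k = 0) (g : Lp ℂ 2 μ)
    (Ψ : Spin D (Fock μ)) (j : Fin D) :
    dressingRemainder M β g Ψ j = ∑ k, (if β j = β k then 0 else M j k •
      ((weyl (β k • g)).symm.trans (weyl (β j • g)) : Fock μ →L[ℂ] Fock μ)) (Ψ k) := by
  have hdressed : (dressing β g).conjStarAlgEquiv (spinAct D (Fock μ) M) Ψ j =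
      ∑ k, M j k • weyl (β j • g) ((weyl (β k • g)).symm (Ψ k)) := by
    change weyl (β j • g) (spinAct D (Fock μ) M ((dressing β g).symm Ψ) j) = _
    simp only [spinAct_apply, map_sum, map_smul]
    rfl
  rw [dressingRemainder, sub_apply, PiLp.sub_apply, hdressed, spinAct_apply,
    ← Finset.sum_sub_distrib]
  refine Finset.sum_congr rfl fun k _ => ?_
  split_ifs with hβ
  · rcases eq_or_ne j k with rfl | hjk
    · simp
    · simp [hMβ j k hjk hβ, hjk]
  · have hjk : j ≠ k := fun h => hβ (congrArg β h)
    simp [hjk]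

theorem isSelfAdjoint_dressingRemainder (hM : M.IsHermitian) (β : Fin D → ℂ) (g : Lp ℂ 2 μ) :
    IsSelfAdjoint (dressingRemainder M β g) := by
  have hM' : IsSelfAdjoint M := hM
  have hdiag : IsSelfAdjoint (Matrix.diagonal M.diag) := isHermitian_diagonal_diag hM
  exact isSelfAdjoint_conjStarAlgEquiv_sub _ (hM'.map (spinAct D (Fock μ)))
    (hdiag.map (spinAct D (Fock μ)))

theorem norm_dressingRemainder_le (M : Matrix (Fin D) (Fin D) ℂ) (β : Fin D → ℂ)
    (g : Lp ℂ 2 μ) : ‖dressingRemainder M β g‖ ≤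
      ‖spinAct D (Fock μ) M‖ + ‖spinAct D (Fock μ) (Matrix.diagonal M.diag)‖ :=
  norm_conjStarAlgEquiv_sub_le _ _ _

theorem graphFormBound_weyl_weyl_symm (hω : Measurable ω) (hm : 0 < m) (hωm : ∀ᵐ k ∂μ, m ≤ ω k)
    {f g : Lp ℂ 2 μ} (hfg : f =ᵐ[μ] fun k => (ω k : ℂ) * g k) (b c : ℂ) :
    GraphFormBound (dGamma μ ω)
      ((weyl (c • g)).symm.trans (weyl (b • g)) : Fock μ →L[ℂ] Fock μ)
      ((1 + 2 * (1 + m⁻¹)) / (1 + ‖b - c‖ * ‖g‖)) := by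
  intro x y x' y' hxy hxy'
  refine (norm_inner_weyl_weyl_symm_le hω hm hωm hfg b c ⟨_, hxy⟩ ⟨_, hxy'⟩).trans ?_
  gcongr <;> exact max_le_add_of_nonneg (norm_nonneg _) (norm_nonneg _)

theorem graphFormBound_dressingRemainder (hω : Measurable ω) (hm : 0 < m)
    (hωm : ∀ᵐ k ∂μ, m ≤ ω k) (hMβ : ∀ j k, j ≠ k → β j = β k → M j k = 0)
    {f g : Lp ℂ 2 μ} (hfg : f =ᵐ[μ] fun k => (ω k : ℂ) * g k) :
    GraphFormBound (directSum fun _ => dGamma μ ω) (dressingRemainder M β g)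
      (decayRate m M β ‖g‖) := by
  refine graphFormBound_directSum (dressingRemainder_apply hMβ g) (fun j k => ?_) fun j k => ?_
  · positivity
  · split_ifs
    · simp [GraphFormBound]
    · exact (graphFormBound_weyl_weyl_symm hω hm hωm hfg _ _).const_smul _

theorem decayRate_nonneg (hm : 0 < m) (M : Matrix (Fin D) (Fin D) ℂ) (β : Fin D → ℂ) {r : ℝ}
    (hr : 0 ≤ r) : 0 ≤ decayRate m M β r :=
  Finset.sum_nonneg fun j _ => Finset.sum_nonneg fun k _ => by positivity

theorem normResolventTendsto_dressing (hω : Measurable ω) (hm : 0 < m) (hωm : ∀ᵐ k ∂μ, m ≤ ω k)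
    (hM : M.IsHermitian) (hMβ : ∀ j k, j ≠ k → β j = β k → M j k = 0) {f g : ℕ → Lp ℂ 2 μ}
    (hfg : ∀ n, f n =ᵐ[μ] fun k => (ω k : ℂ) * g n k)
    (hg : Tendsto (fun n => ‖g n‖) atTop atTop) :
    NormResolventTendsto
      (fun n => ((dressing β (g n)).conjStarAlgEquiv (spinAct D (Fock μ) M) :
        Spin D (Fock μ) →ₗ[ℂ] Spin D (Fock μ)) +ᵥ directSum fun _ : Fin D => dGamma μ ω)
      ((spinAct D (Fock μ) (Matrix.diagonal M.diag) :
        Spin D (Fock μ) →ₗ[ℂ] Spin D (Fock μ)) +ᵥ directSum fun _ : Fin D => dGamma μ ω) := by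
  set S := spinAct D (Fock μ) (Matrix.diagonal M.diag)
  have hsplit (n : ℕ) : ((dressing β (g n)).conjStarAlgEquiv (spinAct D (Fock μ) M) :
      Spin D (Fock μ) →ₗ[ℂ] Spin D (Fock μ)) = dressingRemainder M β (g n) + S := by
    rw [← ContinuousLinearMap.toLinearMap_add, dressingRemainder, sub_add_cancel]
  have hdiag : IsSelfAdjoint (Matrix.diagonal M.diag) := isHermitian_diagonal_diag hM
  have hdGamma : IsSelfAdjoint (directSum fun _ : Fin D => dGamma μ ω) :=
    isSelfAdjoint_directSum fun _ => isSelfAdjoint_dGamma hω (ae_nonneg_of_ae_le hm hωm)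
  have hdecay (n : ℕ) : 0 ≤ decayRate m M β ‖g n‖ := decayRate_nonneg hm M β (norm_nonneg _)
  simp only [hsplit, add_vadd]
  refine normResolventTendsto_of_graphFormBound (isSelfAdjoint_vadd hdGamma (hdiag.map _))
    (fun n => isSelfAdjoint_dressingRemainder hM β (g n))
    (fun n => norm_dressingRemainder_le M β (g n))
    (ε := fun n => decayRate m M β ‖g n‖ * (1 + ‖S‖) ^ 2) (fun n => by have := hdecay n; positivity)
    ?_ fun n => (graphFormBound_dressingRemainder hω hm hωm hMβ (hfg n)).vadd (hdecay n) S
  simpa using ((tendsto_decayRate m M β).comp hg).mul_const ((1 + ‖S‖) ^ 2)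

end Limit

end GSB

end

theorem proposition2p9_general {X : Type*} [MeasurableSpace X] (μ : Measure X) [SigmaFinite μ]
    (ω : X → ℝ) (hω : Measurable ω) (m : ℝ) (hm : 0 < m) (hωm : ∀ᵐ k ∂μ, m ≤ ω k)
    (D : ℕ) (K B : Matrix (Fin D) (Fin D) ℂ) (hK : K.IsHermitian) [IsStarNormal B]
    (f : ℕ → Lp ℂ 2 μ)
    (hf : Tendsto (fun Λ => eLpNorm (fun k => ((ω k)⁻¹ : ℂ) * f Λ k) 2 μ) atTop (𝓝 ∞)) :
    ∃ (η₀ : Matrix (Fin D) (Fin D) ℂ)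
      (W : ℕ → GSB.Spin D (GSB.Fock μ) ≃ₗᵢ[ℂ] GSB.Spin D (GSB.Fock μ)),
      η₀.IsDiag ∧ η₀.IsHermitian ∧
      GSB.NormResolventTendsto
        (fun Λ => GSB.conj (W Λ)
          (GSB.hamiltonian ω K B (f Λ)
            - GSB.spinTensor (GSB.selfEnergy ω B (f Λ)) (GSB.idOp (GSB.Fock μ))))
        (GSB.spinTensor η₀ (GSB.idOp (GSB.Fock μ)) + GSB.spinTensor 1 (GSB.dGamma μ ω)) := by
  obtain ⟨U, β, hB, hKβ⟩ := GSB.exists_unitary_diagonalization (B := B) hK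
  choose g hg hfg using fun Λ => GSB.exists_div_dispersion hω hm hωm (f Λ)
  have hK' : (Unitary.conjStarAlgAut ℂ _ U K).IsHermitian := IsSelfAdjoint.map hK _
  refine ⟨.diagonal (Unitary.conjStarAlgAut ℂ _ U K).diag,
    fun Λ => (GSB.spinRotation U).trans (GSB.dressing β (g Λ)), Matrix.isDiag_diagonal _,
    GSB.isHermitian_diagonal_diag hK', ?_⟩
  rw [GSB.spinTensor_idOp_add, GSB.spinTensor_one]
  simp only [fun Λ => GSB.conj_dressing_hamiltonian K hω hm hωm (hfg Λ) hB]
  exact GSB.normResolventTendsto_dressing hω hm hωm hK' hKβ hfg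
    (GSB.tendsto_norm_of_tendsto_eLpNorm hg hf)

theorem proposition2p9 {X : Type*} [MeasurableSpace X] (μ : Measure X) [SigmaFinite μ]
    (ω : X → ℝ) (hω : Measurable ω) (m : ℝ) (hm : 0 < m) (hωm : ∀ᵐ k ∂μ, m ≤ ω k)
    (D : ℕ) (K B : Matrix (Fin D) (Fin D) ℂ) (hK : K.IsHermitian)
    (hKB : GSB.PermutesEigenbasis K B)
    (f : ℕ → Lp ℂ 2 μ)
    (hf : Tendsto (fun Λ => eLpNorm (fun k => ((ω k)⁻¹ : ℂ) * f Λ k) 2 μ) atTop (𝓝 ∞)) :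
    ∃ (η₀ : Matrix (Fin D) (Fin D) ℂ)
      (W : ℕ → GSB.Spin D (GSB.Fock μ) ≃ₗᵢ[ℂ] GSB.Spin D (GSB.Fock μ)),
      η₀.IsDiag ∧ η₀.IsHermitian ∧
      GSB.NormResolventTendsto
        (fun Λ => GSB.conj (W Λ)
          (GSB.hamiltonian ω K B (f Λ)
            - GSB.spinTensor (GSB.selfEnergy ω B (f Λ)) (GSB.idOp (GSB.Fock μ))))
        (GSB.spinTensor η₀ (GSB.idOp (GSB.Fock μ)) + GSB.spinTensor 1 (GSB.dGamma μ ω)) := by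
  have := isStarNormal_of_mem_unitary hKB.1
  exact proposition2p9_general μ ω hω m hm hωm D K B hK f hf
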